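/- Let $(X,d)$ be a non-empty proper metric space, $1\le p<\infty$, and let $(\mathcal P_p(X),w_p)$ be the Wasserstein space of order $p$: the Borel probability measures $\mu$ with $\int d(x_0,x)^p\,d\mu(x)<\infty$ for $x_0\in X$, with $w_p(\mu,\nu)^p=\inf_\pi\int d(x,y)^p\,d\pi(x,y)$, the infimum being over all couplings $\pi$ of $\mu$ and $\nu$. Its weak topology is the one induced by weak convergence of probability measures. For a map $g$ on $\mathcal P_p(X)$ and $N\subset\mathcal P_p(X)$, let $A_g(N)$ be the set of points $\sigma(0)$ of bounded full orbits $\sigma:\mathbb Z\to N$, $g(\sigma(k))=\sigma(k+1)$. A set $K$ is invariant if $A_g(K)=K$; a closed set $N$ is an isolating neighborhood of the invariant set $K$ if $K\subset\operatorname{int}N$ and $A_g(N)=K$; $N$ is positive $g$-invariant if $g(N)\subset N$. A closed bounded set $N$ is $g$-admissible if, whenever $m_n\to\infty$ and $\mu_n,g(\mu_n),\dots,g^{m_n}(\mu_n)\in N$ for all $n$, the set $\{g^{m_n}(\mu_n)\}_n$ is precompact. An isolated invariant set $K$ is a weak attractor of $g$ if $g$ is continuous both for $w_p$ and for the weak topology,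 and $K$ has a positive $g$-invariant isolating neighborhood $N$ such that every weak limit of a sequence $g^{m_n}(\mu_n)$ with $\mu_n\in N$, $m_n\to\infty$, lies in $K$. A set $S\subset\mathcal P_p(X)$ is called convex if $t\mu_0+(1-t)\mu_1\in S$ for all $\mu_0,\mu_1\in S$ and $t\in[0,1]$. Let $f:X\to X$ be continuous such that push-forward defines a $w_p$-continuous map $f_*:\mathcal P_p(X)\to\mathcal P_p(X)$. Suppose that $f_*$ has a global attractor $K$ (a compact invariant set such that for every bounded $S$ and every $\varepsilon>0$ the set $f_*^n(S)$ lies in the $\varepsilon$-neighborhood of $K$ for all large $n$), and that $f_*$ is uniformly continuous on a neighborhood of $K$. Let $P_n$ be Markov–Wasserstein maps of order $p$ relative to $f$ with noise levels $\varepsilon_n\to0$; that is, each $P_n:\mathcal P_p(X)\to\mathcal P_p(X)$ is continuous, satisfies $P_n(t\mu+(1-t)\nu)=tP_n(\mu)+(1-t)P_n(\nu)$ for all $\mu,\nu\in\mathcal P_p(X)$, $t\in[0,1]$, and is induced by a Markov kernel $x\mapsto p_n(dy|x)\in\mathcal P_p(X)$, $P_n(\mu)=\int p_n(dy|x)\,d\mu(x)$,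 with $\sup_{x}w_p(p_n(dy|x),\delta_{f(x)})\le\varepsilon_n$. Then every isolating neighborhood $N$ of $K$ for $f_*$ contains a convex, positive $f_*$-invariant, $f_*$-admissible isolating neighborhood $B$ of $K$, and there are $r>0$ and $n_0$ such that for every $n\ge n_0$ there is a convex positive $P_n$-invariant set $N_n\subset B$ which contains the $r$-neighborhood of $K$ and is an isolating neighborhood, for $P_n$, of $K_n=A_{P_n}(N_n)$. Here $K_n$ is non-empty and a weakly compact weak attractor of $P_n$, it contains all bounded $P_n$-invariant measures, i.e. $A_{P_n}(\mathcal P_p(X))=K_n$, and there is at least one $\mu\in K_n$ with $P_n(\mu)=\mu$. -/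

import Mathlib

set_option linter.unusedSectionVars false

open MeasureTheory Set Filter Topology
open scoped ENNReal

namespace MarkovWasserstein

/-! ## Wasserstein spaces -/

section Wasserstein

variable {X : Type*} [MetricSpace X] [MeasurableSpace X]

/-- `π` is a coupling (transference plan) of `μ` and `ν`. -/
def IsCoupling (π : Measure (X × X)) (μ ν : Measure X) : Prop :=
  π.map Prod.fst = μ ∧ π.map Prod.snd = ν

/-- The transport cost `∫ d(x,y)^p dπ(x,y)`. -/
noncomputable def cost (p : ℝ) (π : Measure (X × X)) : ℝ≥0∞ :=
  ∫⁻ z, edist z.1 z.2 ^ p ∂π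

/-- The Wasserstein distance `w_p(μ, ν) = (inf_π ∫ d(x,y)^p dπ)^(1/p)`, with values in `[0, ∞]`. -/
noncomputable def wEDist (p : ℝ) (μ ν : Measure X) : ℝ≥0∞ :=
  (⨅ (π : Measure (X × X)) (_ : IsCoupling π μ ν), cost p π) ^ (1 / p)

/-- The Wasserstein space of order `p`: the Borel probability measures on `X` with
`∫ d(x₀, x)^p dμ(x) < ∞` for every (equivalently, for some) base point `x₀`. -/
structure WassersteinSpace (p : ℝ) (X : Type*) [MetricSpace X] [MeasurableSpace X] where
  /-- the underlying probability measure -/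
  toProb : ProbabilityMeasure X
  moment : ∀ x₀ : X, ∫⁻ x, edist x₀ x ^ p ∂(toProb : Measure X) < ∞

namespace WassersteinSpace

/-- The underlying Borel measure. -/
def toMeasure {p : ℝ} (μ : WassersteinSpace p X) : Measure X := (μ.toProb : Measure X)

instance {p : ℝ} (μ : WassersteinSpace p X) : IsProbabilityMeasure μ.toMeasure :=
  inferInstanceAs (IsProbabilityMeasure (μ.toProb : Measure X))

theorem toMeasure_injective {p : ℝ} :
    Function.Injective (toMeasure : WassersteinSpace p X → Measure X) := by
  rintro ⟨μ, hμ⟩ ⟨ν, hν⟩ h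
  have : μ = ν := Subtype.ext h
  subst this
  rfl

end WassersteinSpace

theorem wEDist_le {p : ℝ} (hp : 1 ≤ p) {π : Measure (X × X)} {μ ν : Measure X}
    (h : IsCoupling π μ ν) : wEDist p μ ν ≤ cost p π ^ (1 / p) :=
  ENNReal.rpow_le_rpow (iInf₂_le π h) (by positivity)

/-- Near-optimal couplings exist. -/
theorem exists_coupling_lt {p : ℝ} (hp : 1 ≤ p) {μ ν : Measure X} {a : ℝ≥0∞}
    (h : wEDist p μ ν < a) : ∃ π, IsCoupling π μ ν ∧ cost p π ^ (1 / p) < a := by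
  have hp0 : 0 < p := by linarith
  have h1 : (⨅ (π : Measure (X × X)) (_ : IsCoupling π μ ν), cost p π) < a ^ p := by
    rw [wEDist, one_div, ENNReal.rpow_inv_lt_iff hp0] at h
    exact h
  obtain ⟨π, hπ⟩ := iInf_lt_iff.1 h1
  obtain ⟨hc, hπ⟩ := iInf_lt_iff.1 hπ
  refine ⟨π, hc, ?_⟩
  rwa [one_div, ENNReal.rpow_inv_lt_iff hp0]

theorem IsCoupling.swap {π : Measure (X × X)} {μ ν : Measure X} (h : IsCoupling π μ ν) :
    IsCoupling (π.map Prod.swap) ν μ := by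
  constructor
  · rw [Measure.map_map measurable_fst measurable_swap]; exact h.2
  · rw [Measure.map_map measurable_snd measurable_swap]; exact h.1

variable [BorelSpace X] [SecondCountableTopology X]

theorem measurable_cost_integrand (p : ℝ) : Measurable fun z : X × X => edist z.1 z.2 ^ p :=
  (measurable_fst.edist measurable_snd).pow_const p

theorem wEDist_self {p : ℝ} (hp : 1 ≤ p) (μ : Measure X) : wEDist p μ μ = 0 := by
  have hp0 : 0 < p := by linarith
  have hm : Measurable fun x : X => (x, x) := measurable_id.prodMk measurable_id
  have hc : IsCoupling (μ.map fun x => (x, x)) μ μ := by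
    constructor
    · rw [Measure.map_map measurable_fst hm]; exact Measure.map_id
    · rw [Measure.map_map measurable_snd hm]; exact Measure.map_id
  have := wEDist_le hp hc
  rw [cost, lintegral_map (measurable_cost_integrand p) hm] at this
  simpa [hp0] using this

theorem wEDist_comm_le (p : ℝ) (hp : 1 ≤ p) (μ ν : Measure X) :
    wEDist p μ ν ≤ wEDist p ν μ := by
  unfold wEDist
  refine ENNReal.rpow_le_rpow (le_iInf₂ fun (π : Measure (X × X)) hπ => ?_) (by positivity)
  refine (iInf₂_le (π.map Prod.swap) hπ.swap).trans ?_
  rw [cost, lintegral_map (measurable_cost_integrand p) measurable_swap, cost]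
  simp [edist_comm]

/-- Gluing of two couplings along their common marginal. -/
theorem exists_gluing [CompleteSpace X] {π₁ π₂ : Measure (X × X)}
    {μ ν ρ : Measure X} [IsProbabilityMeasure μ] [IsProbabilityMeasure ν]
    (h₁ : IsCoupling π₁ μ ν) (h₂ : IsCoupling π₂ ν ρ) :
    ∃ γ : Measure (X × X × X),
      γ.map (fun q => (q.2.1, q.1)) = π₁ ∧ γ.map (fun q => (q.1, q.2.2)) = π₂ := by
  have : Nonempty X := nonempty_of_isProbabilityMeasure μ
  have i₁ : IsProbabilityMeasure π₁ := by
    have : IsProbabilityMeasure (π₁.map Prod.fst) := by rw [h₁.1]; infer_instance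
    exact Measure.isProbabilityMeasure_of_map Prod.fst
  have i₂ : IsProbabilityMeasure π₂ := by
    have : IsProbabilityMeasure (π₂.map Prod.fst) := by rw [h₂.1]; infer_instance
    exact Measure.isProbabilityMeasure_of_map Prod.fst
  have i₃ : IsProbabilityMeasure (π₁.map Prod.swap) :=
    Measure.isProbabilityMeasure_map measurable_swap.aemeasurable
  set κ₁ := (π₁.map Prod.swap).condKernel with hκ₁
  set κ₂ := π₂.condKernel with hκ₂
  have e₁ : ν.compProd κ₁ = π₁.map Prod.swap := by
    have h := (π₁.map Prod.swap).disintegrate κ₁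
    have hf : (π₁.map Prod.swap).fst = ν := h₁.swap.1
    rwa [hf] at h
  have e₂ : ν.compProd κ₂ = π₂ := by
    have h := π₂.disintegrate κ₂
    have hf : π₂.fst = ν := h₂.1
    rwa [hf] at h
  refine ⟨ν.compProd (κ₁.prod κ₂), ?_, ?_⟩
  · have key : (ν.compProd (κ₁.prod κ₂)).map (fun q => (q.1, q.2.1)) = ν.compProd κ₁ := by
      ext s hs
      have hm : Measurable fun q : X × X × X => (q.1, q.2.1) := by fun_prop
      rw [Measure.map_apply hm hs, Measure.compProd_apply (hm hs), Measure.compProd_apply hs]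
      refine lintegral_congr fun y => ?_
      rw [ProbabilityTheory.Kernel.prod_apply]
      have : (Prod.mk y ⁻¹' ((fun q : X × X × X => (q.1, q.2.1)) ⁻¹' s))
          = (Prod.mk y ⁻¹' s) ×ˢ (univ : Set X) := by
        ext z; simp
      rw [this, Measure.prod_prod, measure_univ, mul_one]
    have h := congrArg (Measure.map Prod.swap) key
    rw [e₁, Measure.map_map measurable_swap (by fun_prop),
      Measure.map_map measurable_swap measurable_swap] at h
    simpa [Function.comp_def] using h
  · rw [← e₂]
    ext s hs
    have hm : Measurable fun q : X × X × X => (q.1, q.2.2) := by fun_prop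
    rw [Measure.map_apply hm hs, Measure.compProd_apply (hm hs), Measure.compProd_apply hs]
    refine lintegral_congr fun y => ?_
    rw [ProbabilityTheory.Kernel.prod_apply]
    have : (Prod.mk y ⁻¹' ((fun q : X × X × X => (q.1, q.2.2)) ⁻¹' s))
        = (univ : Set X) ×ˢ (Prod.mk y ⁻¹' s) := by
      ext z; simp
    rw [this, Measure.prod_prod, measure_univ, one_mul]

theorem wEDist_triangle [CompleteSpace X] {p : ℝ} (hp : 1 ≤ p) (μ ν ρ : Measure X)
    [IsProbabilityMeasure μ] [IsProbabilityMeasure ν] :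
    wEDist p μ ρ ≤ wEDist p μ ν + wEDist p ν ρ := by
  have hp0 : 0 < p := by linarith
  refine le_of_forall_gt fun c hc => ?_
  obtain ⟨a, ha, b, hb, hab⟩ : ∃ a, wEDist p μ ν < a ∧ ∃ b, wEDist p ν ρ < b ∧ a + b ≤ c := by
    obtain ⟨d, hd, hdc⟩ := exists_between hc
    have hft : wEDist p μ ν + wEDist p ν ρ ≠ ∞ := (lt_top_of_lt hc).ne
    have h1 : wEDist p μ ν ≠ ∞ := fun h => hft (by simp [h])
    have h2 : wEDist p ν ρ ≠ ∞ := fun h => hft (by simp [h])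
    obtain ⟨e, he, hec⟩ := ENNReal.lt_iff_exists_add_pos_lt.1 hc
    have he2 : ((e / 2 : NNReal) : ℝ≥0∞) ≠ 0 := by simpa using he.ne'
    refine ⟨wEDist p μ ν + (e / 2 : NNReal), ENNReal.lt_add_right h1 he2,
      wEDist p ν ρ + (e / 2 : NNReal), ENNReal.lt_add_right h2 he2, ?_⟩
    refine le_trans (le_of_eq ?_) hec.le
    rw [add_add_add_comm, ← ENNReal.coe_add, add_halves]
  obtain ⟨π₁, h₁, c₁⟩ := exists_coupling_lt hp ha
  obtain ⟨π₂, h₂, c₂⟩ := exists_coupling_lt hp hb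
  obtain ⟨γ, g₁, g₂⟩ := exists_gluing h₁ h₂
  have m₁ : Measurable fun q : X × X × X => (q.2.1, q.1) := by fun_prop
  have m₂ : Measurable fun q : X × X × X => (q.1, q.2.2) := by fun_prop
  have m₃ : Measurable fun q : X × X × X => (q.2.1, q.2.2) := by fun_prop
  have hcp : IsCoupling (γ.map fun q => (q.2.1, q.2.2)) μ ρ := by
    constructor
    · rw [Measure.map_map measurable_fst m₃, ← h₁.1, ← g₁, Measure.map_map measurable_fst m₁]
      rfl
    · rw [Measure.map_map measurable_snd m₃, ← h₂.2, ← g₂, Measure.map_map measurable_snd m₂]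
      rfl
  refine lt_of_le_of_lt (wEDist_le hp hcp) (lt_of_lt_of_le ?_ hab)
  refine lt_of_le_of_lt ?_ (ENNReal.add_lt_add c₁ c₂)
  rw [← g₁, ← g₂, cost, cost, cost, lintegral_map (measurable_cost_integrand p) m₁,
    lintegral_map (measurable_cost_integrand p) m₂, lintegral_map (measurable_cost_integrand p) m₃]
  have n₁ : Measurable fun q : X × X × X => edist q.2.1 q.1 := by fun_prop
  have n₂ : Measurable fun q : X × X × X => edist q.1 q.2.2 := by fun_prop
  refine le_trans ?_ (ENNReal.lintegral_Lp_add_le n₁.aemeasurable n₂.aemeasurable hp)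
  refine ENNReal.rpow_le_rpow (lintegral_mono fun q => ?_) (by positivity)
  exact ENNReal.rpow_le_rpow (edist_triangle _ _ _) hp0.le

/-- A coupling with a point mass exists, so `w_p(δ_{x₀}, μ)` is controlled by the moment. -/
theorem wEDist_dirac_le {p : ℝ} (hp : 1 ≤ p) (x₀ : X) (μ : Measure X)
    [IsProbabilityMeasure μ] :
    wEDist p (Measure.dirac x₀) μ ≤ (∫⁻ x, edist x₀ x ^ p ∂μ) ^ (1 / p) := by
  have hm : Measurable fun x : X => (x₀, x) := by fun_prop
  have hc : IsCoupling (μ.map fun x => (x₀, x)) (Measure.dirac x₀) μ := by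
    constructor
    · rw [Measure.map_map measurable_fst hm]
      have : (Prod.fst ∘ fun x : X => (x₀, x)) = fun _ => x₀ := rfl
      rw [this, Measure.map_const, measure_univ, one_smul]
    · rw [Measure.map_map measurable_snd hm]; exact Measure.map_id
  refine (wEDist_le hp hc).trans_eq ?_
  rw [cost, lintegral_map (measurable_cost_integrand p) hm]

theorem wEDist_ne_top [CompleteSpace X] {p : ℝ} (hp : 1 ≤ p) (μ ν : WassersteinSpace p X) :
    wEDist p μ.toMeasure ν.toMeasure ≠ ∞ := by
  obtain ⟨x₀⟩ : Nonempty X := nonempty_of_isProbabilityMeasure μ.toMeasure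
  have hfin : ∀ ρ : WassersteinSpace p X, wEDist p (Measure.dirac x₀) ρ.toMeasure < ∞ := by
    intro ρ
    refine (wEDist_dirac_le hp x₀ ρ.toMeasure).trans_lt ?_
    exact ENNReal.rpow_lt_top_of_nonneg (by positivity) (ρ.moment x₀).ne
  refine ne_top_of_le_ne_top ?_ (wEDist_triangle hp μ.toMeasure (Measure.dirac x₀) ν.toMeasure)
  exact (ENNReal.add_lt_top.2
    ⟨(wEDist_comm_le p hp _ _).trans_lt (hfin μ), hfin ν⟩).ne

theorem eq_of_wEDist_eq_zero {p : ℝ} (hp : 1 ≤ p) {μ ν : Measure X}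
    [IsProbabilityMeasure μ] [IsProbabilityMeasure ν] (h : wEDist p μ ν = 0) : μ = ν := by
  have hp0 : 0 < p := by linarith
  have hLP : levyProkhorovEDist μ ν = 0 := by
    refine le_antisymm (levyProkhorovEDist_le_of_forall_le μ ν 0 fun ε B hε hεt hB => ?_) zero_le
    have hεp : 0 < ε * ε ^ (1 / p) :=
      ENNReal.mul_pos hε.ne' (ENNReal.rpow_pos hε hεt.ne).ne'
    obtain ⟨π, hc, hπ⟩ := exists_coupling_lt hp (h ▸ hεp)
    have hcost : cost p π ≤ ε ^ p * ε := by
      have := ENNReal.rpow_le_rpow hπ.le hp0.le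
      rw [← ENNReal.rpow_mul, one_div, inv_mul_cancel₀ hp0.ne', ENNReal.rpow_one,
        ENNReal.mul_rpow_of_nonneg _ _ hp0.le, ← ENNReal.rpow_mul, inv_mul_cancel₀ hp0.ne',
        ENNReal.rpow_one] at this
      exact this
    have hmk : π {z | ε ^ p ≤ edist z.1 z.2 ^ p} ≤ ε := by
      have h1 := mul_meas_ge_le_lintegral (μ := π) (measurable_cost_integrand (X := X) p) (ε ^ p)
      have h2 := h1.trans hcost
      have h3 : ε ^ p ≠ 0 := (ENNReal.rpow_pos hε hεt.ne).ne'
      have h4 : ε ^ p ≠ ∞ := ENNReal.rpow_ne_top_of_nonneg hp0.le hεt.ne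
      exact (ENNReal.mul_le_mul_iff_right h3 h4).1 h2
    have hB' : MeasurableSet (Metric.thickening ε.toReal B) :=
      Metric.isOpen_thickening.measurableSet
    have e1 : μ B = π (Prod.fst ⁻¹' B) := by
      rw [← hc.1, Measure.map_apply measurable_fst hB]
    have e2 : ν (Metric.thickening ε.toReal B)
        = π (Prod.snd ⁻¹' (Metric.thickening ε.toReal B)) := by
      rw [← hc.2, Measure.map_apply measurable_snd hB']
    rw [e1, e2]
    refine (measure_mono ?_).trans ((measure_union_le _ _).trans (add_le_add le_rfl hmk))
    intro z hz
    by_cases hd : ε ^ p ≤ edist z.1 z.2 ^ p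
    · exact Or.inr hd
    · refine Or.inl ?_
      have hlt : edist z.1 z.2 < ε := by
        by_contra hcon
        exact hd (ENNReal.rpow_le_rpow (not_lt.1 hcon) hp0.le)
      refine Metric.mem_thickening_iff.2 ⟨z.1, hz, ?_⟩
      rw [dist_comm, dist_edist]
      exact (ENNReal.toReal_lt_toReal (edist_ne_top _ _) hεt.ne).2 hlt
  refine ext_of_generate_finite _ ?_ isPiSystem_isClosed (fun A hA => ?_) (by simp)
  · rw [BorelSpace.measurable_eq (α := X), borel_eq_generateFrom_isClosed]
  · exact measure_eq_measure_of_levyProkhorovEDist_eq_zero_of_isClosed hLP hA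
      ⟨1, one_pos, measure_ne_top _ _⟩ ⟨1, one_pos, measure_ne_top _ _⟩

/-- The metric space `(𝒫_p(X), w_p)`. -/
noncomputable instance [CompleteSpace X] {p : ℝ} [hp : Fact (1 ≤ p)] :
    MetricSpace (WassersteinSpace p X) where
  dist μ ν := (wEDist p μ.toMeasure ν.toMeasure).toReal
  dist_self μ := by simp [wEDist_self hp.out]
  dist_comm μ ν := by
    rw [le_antisymm (wEDist_comm_le p hp.out μ.toMeasure ν.toMeasure)
      (wEDist_comm_le p hp.out ν.toMeasure μ.toMeasure)]
  dist_triangle μ ν ρ := by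
    rw [← ENNReal.toReal_add (wEDist_ne_top hp.out μ ν) (wEDist_ne_top hp.out ν ρ)]
    exact ENNReal.toReal_mono
      (ENNReal.add_ne_top.2 ⟨wEDist_ne_top hp.out μ ν, wEDist_ne_top hp.out ν ρ⟩)
      (wEDist_triangle hp.out μ.toMeasure ν.toMeasure ρ.toMeasure)
  eq_of_dist_eq_zero := by
    intro μ ν h
    have h0 := ((ENNReal.toReal_eq_zero_iff _).1 h).resolve_right (wEDist_ne_top hp.out μ ν)
    exact WassersteinSpace.toMeasure_injective (eq_of_wEDist_eq_zero hp.out h0)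

theorem dist_eq_wEDist [CompleteSpace X] {p : ℝ} [Fact (1 ≤ p)] (μ ν : WassersteinSpace p X) :
    dist μ ν = (wEDist p μ.toMeasure ν.toMeasure).toReal := rfl

/-- The weak topology of `𝒫_p(X)`: the subspace topology of `𝒫_p(X) ⊆ 𝒫(X)`, where `𝒫(X)`
carries the topology of convergence against bounded continuous functions. -/
@[reducible] noncomputable def weakTopology (p : ℝ) (X : Type*) [MetricSpace X] [MeasurableSpace X] [BorelSpace X] :
    TopologicalSpace (WassersteinSpace p X) :=
  TopologicalSpace.induced WassersteinSpace.toProb inferInstance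

/-- The point mass `δ_x` as an element of `𝒫_p(X)`. -/
noncomputable def diracW (p : ℝ) [hp : Fact (1 ≤ p)] (x : X) : WassersteinSpace p X where
  toProb := ⟨Measure.dirac x, inferInstance⟩
  moment x₀ := by
    have hp0 : (0 : ℝ) ≤ p := by linarith [hp.out]
    have : ∫⁻ y, edist x₀ y ^ p ∂(Measure.dirac x) < ∞ := by
      rw [lintegral_dirac]
      exact ENNReal.rpow_lt_top_of_nonneg hp0 (edist_ne_top _ _)
    exact this

/-- The mixture `t μ + (1 - t) ν` of two elements of `𝒫_p(X)`. -/
noncomputable def mix {p : ℝ} (t : unitInterval) (μ ν : WassersteinSpace p X) :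
    WassersteinSpace p X where
  toProb := ⟨ENNReal.ofReal (t : ℝ) • μ.toMeasure + ENNReal.ofReal (1 - (t : ℝ)) • ν.toMeasure, by
    constructor
    simp only [Measure.add_apply, Measure.smul_apply, measure_univ, smul_eq_mul, mul_one]
    rw [← ENNReal.ofReal_add t.2.1 (by linarith [t.2.2])]
    simp⟩
  moment x₀ := by
    have : ∫⁻ x, edist x₀ x ^ p ∂(ENNReal.ofReal (t : ℝ) • μ.toMeasure
        + ENNReal.ofReal (1 - (t : ℝ)) • ν.toMeasure) < ∞ := by
      rw [lintegral_add_measure, lintegral_smul_measure, lintegral_smul_measure]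
      exact ENNReal.add_lt_top.2 ⟨ENNReal.mul_lt_top ENNReal.ofReal_lt_top (μ.moment x₀),
        ENNReal.mul_lt_top ENNReal.ofReal_lt_top (ν.moment x₀)⟩
    exact this

/-- A set of measures is convex if it is closed under mixtures. -/
def IsMixtureConvex {p : ℝ} (S : Set (WassersteinSpace p X)) : Prop :=
  ∀ μ₀ ∈ S, ∀ μ₁ ∈ S, ∀ t : unitInterval, mix t μ₀ μ₁ ∈ S

end Wasserstein

/-! ## Isolated invariant sets of discrete-time dynamical systems -/

section Conley

variable {Y : Type*} [MetricSpace Y]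

/-- The maximal invariant set `A_g(N)` in `N`: the points of `N` through which there is a bounded
full orbit `σ : ℤ → N`.  For bounded `N` the boundedness of the orbit is automatic and `A_g(N)` is
the intersection of the maximal positive and the maximal negative invariant set in `N`; for
unbounded `N` only bounded orbits are taken into account. -/
def maxInvariant (g : Y → Y) (N : Set Y) : Set Y :=
  {x | ∃ σ : ℤ → Y, σ 0 = x ∧ (∀ k, σ k ∈ N) ∧ (∀ k, g (σ k) = σ (k + 1)) ∧
    Bornology.IsBounded (range σ)}

/-- `N` is an isolating neighborhood of the invariant set `K`. -/
structure IsIsolatingNhd (g : Y → Y) (N K : Set Y) : Prop where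
  invariant : maxInvariant g K = K
  isClosed : IsClosed N
  subset_interior : K ⊆ interior N
  eq : maxInvariant g N = K

/-- A closed bounded set `N` is `g`-admissible if for all `x_n ∈ Y` and `m_n → ∞` such that
`x_n, g(x_n), …, g^{m_n}(x_n)` lie in `N`, the endpoints `g^{m_n}(x_n)` form a precompact set. -/
structure IsAdmissible (g : Y → Y) (N : Set Y) : Prop where
  isClosed : IsClosed N
  isBounded : Bornology.IsBounded N
  precompact : ∀ (x : ℕ → Y) (m : ℕ → ℕ), Tendsto m atTop atTop →
    (∀ n, ∀ k ≤ m n, g^[k] (x n) ∈ N) →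
      IsCompact (closure (range fun n => g^[m n] (x n)))

/-- `K` is the global attractor of `g`: it is compact, invariant and attracts all bounded sets. -/
structure IsGlobalAttractor (g : Y → Y) (K : Set Y) : Prop where
  isCompact : IsCompact K
  invariant : maxInvariant g K = K
  attracts : ∀ S : Set Y, Bornology.IsBounded S → ∀ ε > 0, ∀ᶠ n in atTop,
    g^[n] '' S ⊆ Metric.thickening ε K

/-- The weak `ω`-limit set of `N` with respect to a second topology `τ`. -/
def weakOmega (τ : TopologicalSpace Y) (g : Y → Y) (N : Set Y) : Set Y :=
  {y | ∃ (x : ℕ → Y) (m : ℕ → ℕ), (∀ n, x n ∈ N) ∧ Tendsto m atTop atTop ∧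
    Tendsto (fun n => g^[m n] (x n)) atTop (@nhds Y τ y)}

/-- `K` is a weak attractor of `g` with respect to the weaker topology `τ`: `g` is continuous for
both topologies and `K` has a positive invariant isolating neighborhood `N` whose weak `ω`-limit
set is contained in `K`. -/
structure IsWeakAttractor (τ : TopologicalSpace Y) (g : Y → Y) (K : Set Y) : Prop where
  continuous : Continuous g
  weakly_continuous : @Continuous Y Y τ τ g
  exists_nhd : ∃ N, IsIsolatingNhd g N K ∧ MapsTo g N N ∧ weakOmega τ g N ⊆ K

end Conley

/-! ## Markov-Wasserstein maps -/

section MWMaps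

variable {X : Type*} [MetricSpace X] [MeasurableSpace X] [BorelSpace X]
  [SecondCountableTopology X] [CompleteSpace X] {p : ℝ} [Fact (1 ≤ p)]

/-- `F` is the transfer map `f_* : 𝒫_p(X) → 𝒫_p(X)`, given by push-forward under `f`. -/
def IsTransferMap (f : X → X) (F : WassersteinSpace p X → WassersteinSpace p X) : Prop :=
  ∀ μ, (F μ).toMeasure = μ.toMeasure.map f

/-- `P` is a Markov-Wasserstein map of order `p` relative to `f` with noise level at most `M`:
it is continuous, convex linear, and induced by a kernel `κ(dy|x)` with values in `𝒫_p(X)` such that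
`w_p(κ(dy|x), δ_{f(x)}) ≤ M` for all `x`. -/
structure IsMWMap (f : X → X) (M : ℝ) (P : WassersteinSpace p X → WassersteinSpace p X) :
    Prop where
  continuous : Continuous P
  convex_linear : ∀ (t : unitInterval) (μ ν : WassersteinSpace p X),
    P (mix t μ ν) = mix t (P μ) (P ν)
  kernel : ∃ κ : X → WassersteinSpace p X, Measurable (fun x => (κ x).toMeasure) ∧
    (∀ μ, (P μ).toMeasure = μ.toMeasure.bind fun x => (κ x).toMeasure) ∧
    ∀ x, dist (κ x) (diracW p (f x)) ≤ M

end MWMaps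

end MarkovWasserstein

/-! Bounded sets of measures are rarely compact for w_p, but on a proper space suitable
neighborhoods of a compact set are weakly compact. The proof combines w_p-estimates for the
dynamics, weak compactness for limits, and affinity of the maps.

`K` consists of all points on bounded full orbits of the affine map `F`, so it is convex. The tube
`couplingNhd K c`, defined by a bound on the cost of a plan rather than on w_p, is convex because
cost is linear in the plan, and weakly compact by Prokhorov's theorem and lower semicontinuity of
cost. Passing to the points whose forward orbit stays in the tube, first under `F` and then under `P
n`, gives `B` and `Nn`; convexity and both kinds of closedness survive.

That these cores contain a uniform neighborhood of `K` is stability (`IsGlobalAttractor.stable`,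
`IsGlobalAttractor.eventually_perturbation`): the kernel itself couples `P n μ` with `F μ` at cost
at most `ε n ^ p`, so the two maps stay close over a fixed time `T`, after which attraction has
brought the orbit back. The same estimate places the invariant set of `P n` well inside that
neighborhood.

This gap excludes bounded orbits elsewhere (`maxInvariant_univ_eq_of_gap`): mixing such an orbit in
small portions into an orbit inside `Nn` never leaves `Nn`, yet converges to the foreign orbit. A
fixed point comes from Cesàro means (`IsMWMap.exists_fixed`), and the weak attractor property from
compactness of the space of orbits. -/

namespace MarkovWasserstein

/-! ### Global attractors and their uniform perturbations -/

section Dynamics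

variable {Y : Type*}

/-- The points whose whole forward orbit under `g` stays in `D`. -/
def forwardCore (g : Y → Y) (D : Set Y) : Set Y := {x | ∀ k : ℕ, g^[k] x ∈ D}

theorem forwardCore_subset (g : Y → Y) (D : Set Y) : forwardCore g D ⊆ D := fun _ hx => hx 0

theorem mapsTo_forwardCore (g : Y → Y) (D : Set Y) :
    MapsTo g (forwardCore g D) (forwardCore g D) := fun x hx k => by
  simpa [Function.iterate_succ_apply] using hx (k + 1)

theorem isClosed_forwardCore [TopologicalSpace Y] {g : Y → Y} (hg : Continuous g) {D : Set Y}
    (hD : IsClosed D) : IsClosed (forwardCore g D) := by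
  rw [show forwardCore g D = ⋂ k : ℕ, g^[k] ⁻¹' D by ext; simp [forwardCore]]
  exact isClosed_iInter fun k => hD.preimage (hg.iterate k)

theorem iterate_orbit {g : Y → Y} {σ : ℤ → Y} (h : ∀ k, g (σ k) = σ (k + 1)) (n : ℕ)
    (k : ℤ) :
    g^[n] (σ k) = σ (k + n) := by
  induction n with
  | zero => simp
  | succ n ih => rw [Function.iterate_succ_apply', ih, h]; push_cast; ring_nf

variable [MetricSpace Y]

theorem maxInvariant_mono (g : Y → Y) {M N : Set Y} (h : M ⊆ N) :
    maxInvariant g M ⊆ maxInvariant g N :=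
  fun _ ⟨σ, h0, h1, h2, h3⟩ => ⟨σ, h0, fun k => h (h1 k), h2, h3⟩

theorem maxInvariant_subset (g : Y → Y) (N : Set Y) : maxInvariant g N ⊆ N :=
  fun _ ⟨_, h0, h1, _, _⟩ => h0 ▸ h1 0

theorem orbit_mem_maxInvariant {g : Y → Y} {N : Set Y} {σ : ℤ → Y} (h1 : ∀ k, σ k ∈ N)
    (h2 : ∀ k, g (σ k) = σ (k + 1)) (h3 : Bornology.IsBounded (range σ)) (k : ℤ) :
    σ k ∈ maxInvariant g N :=
  ⟨fun j => σ (k + j), by simp, fun j => h1 _, fun j => by rw [h2, add_assoc],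
    h3.subset (range_subset_iff.2 fun j => mem_range_self _)⟩

theorem maxInvariant_maxInvariant (g : Y → Y) (N : Set Y) :
    maxInvariant g (maxInvariant g N) = maxInvariant g N := by
  refine (maxInvariant_subset g _).antisymm ?_
  rintro x ⟨σ, h0, h1, h2, h3⟩
  exact ⟨σ, h0, fun k => orbit_mem_maxInvariant h1 h2 h3 k, h2, h3⟩

theorem mem_maxInvariant_of_fixed {g : Y → Y} {N : Set Y} {x : Y} (hx : x ∈ N) (h : g x = x) :
    x ∈ maxInvariant g N :=
  ⟨fun _ => x, rfl, fun _ => hx, fun _ => h,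
    Bornology.isBounded_singleton.subset (range_subset_iff.2 fun _ => rfl)⟩

/-- A sequence that approaches a compact set is precompact. -/
theorem isCompact_closure_range_of_eventually_mem_thickening {K : Set Y} (hK : IsCompact K)
    {y : ℕ → Y} (hy : ∀ ε > 0, ∀ᶠ n in atTop, y n ∈ Metric.thickening ε K) :
    IsCompact (closure (range y)) := by
  -- A finite subcover of `K` already covers a neighborhood of `K`, hence all but finitely many `y
  -- n`.
  have hc : IsCompact (K ∪ range y) := by
    refine isCompact_of_finite_subcover fun {ι} U hU hcov => ?_
    obtain ⟨t, ht⟩ := hK.elim_finite_subcover U hU (subset_union_left.trans hcov)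
    obtain ⟨δ, hδ, hsub⟩ := hK.exists_thickening_subset_open
      (isOpen_biUnion fun i (_ : i ∈ t) => hU i) ht
    obtain ⟨n₀, hn₀⟩ := eventually_atTop.1 (hy δ hδ)
    have hcov' : ∀ n, ∃ i, y n ∈ U i := fun n => mem_iUnion.1 (hcov (Or.inr (mem_range_self n)))
    choose c hc using hcov'
    classical
    refine ⟨t ∪ (Finset.range n₀).image c, ?_⟩
    rintro x (hx | ⟨n, rfl⟩)
    · exact biUnion_subset_biUnion_left (fun i hi => Finset.mem_union_left _ hi) (ht hx)
    · by_cases hn : n₀ ≤ n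
      · exact biUnion_subset_biUnion_left (fun i hi => Finset.mem_union_left _ hi)
          (hsub (hn₀ n hn))
      · exact mem_biUnion (Finset.mem_union_right _ (Finset.mem_image_of_mem c
          (Finset.mem_range.2 (not_le.1 hn)))) (hc n)
  exact hc.closure_of_subset subset_union_right

namespace IsGlobalAttractor

variable {F : Y → Y} {K : Set Y}

theorem mapsTo (hK : IsGlobalAttractor F K) : MapsTo F K K := by
  intro x hx
  rw [← hK.invariant] at hx
  obtain ⟨σ, rfl, h1, h2, -⟩ := hx
  rw [h2]
  exact h1 _

/-- Every point of a bounded full orbit is the `n`-th image of another point of that bounded orbit,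
for all `n`; attraction puts it in each neighborhood of the closed set `K`. -/
theorem maxInvariant_univ (hK : IsGlobalAttractor F K) : maxInvariant F univ = K := by
  refine Subset.antisymm ?_ ?_
  · rintro x ⟨σ, rfl, -, h2, h3⟩
    rw [← hK.isCompact.isClosed.closure_eq, Metric.closure_eq_iInter_thickening]
    refine mem_iInter₂.2 fun ε hε => ?_
    obtain ⟨n, hn⟩ := (hK.attracts _ h3 ε hε).exists
    refine hn ⟨σ (-n), mem_range_self _, ?_⟩
    rw [iterate_orbit h2]; simp
  · conv_lhs => rw [← hK.invariant]
    exact maxInvariant_mono F (subset_univ _)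

theorem nonempty [Nonempty Y] (hK : IsGlobalAttractor F K) : K.Nonempty := by
  obtain ⟨y⟩ := ‹Nonempty Y›
  obtain ⟨n, hn⟩ := (hK.attracts {y} Bornology.isBounded_singleton 1 one_pos).exists
  have := hn (mem_image_of_mem _ (mem_singleton y))
  obtain ⟨z, hz, -⟩ := Metric.mem_thickening_iff.1 this
  exact ⟨z, hz⟩

/-- A global attractor is Lyapunov stable. -/
theorem stable (hK : IsGlobalAttractor F K) (hF : Continuous F) {δ : ℝ} (hδ : 0 < δ) :
    ∃ r > 0, ∀ n, MapsTo F^[n] (Metric.thickening r K) (Metric.thickening δ K) := by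
  -- Attraction of the 1-neighborhood settles all times `n ≥ n₀`; the finitely many earlier ones are
  -- continuity conditions.
  obtain ⟨n₀, hn₀⟩ := eventually_atTop.1
    (hK.attracts (Metric.thickening 1 K) hK.isCompact.isBounded.thickening δ hδ)
  have hO : IsOpen (⋂ n ∈ Finset.range n₀, F^[n] ⁻¹' Metric.thickening δ K) :=
    isOpen_biInter_finset fun n _ => Metric.isOpen_thickening.preimage (hF.iterate n)
  have hsub : K ⊆ ⋂ n ∈ Finset.range n₀, F^[n] ⁻¹' Metric.thickening δ K :=
    fun x hx => mem_iInter₂.2 fun n _ =>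
      Metric.self_subset_thickening hδ K (hK.mapsTo.iterate n hx)
  obtain ⟨r, hr, hrsub⟩ := hK.isCompact.exists_thickening_subset_open hO hsub
  refine ⟨min r 1, lt_min hr one_pos, fun n x hx => ?_⟩
  by_cases hn : n₀ ≤ n
  · exact hn₀ n hn (mem_image_of_mem _ (Metric.thickening_mono (min_le_right _ _) K hx))
  · exact mem_iInter₂.1 (hrsub (Metric.thickening_mono (min_le_left _ _) K hx)) n
      (Finset.mem_range.2 (not_le.1 hn))

theorem isIsolatingNhd_forwardCore (hK : IsGlobalAttractor F K) (hF : Continuous F) {D : Set Y}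
    (hD : IsClosed D) {δ : ℝ} (hδ : 0 < δ) (hsub : Metric.thickening δ K ⊆ D) :
    IsIsolatingNhd F (forwardCore F D) K := by
  obtain ⟨r, hr, hrs⟩ := hK.stable hF hδ
  have hint : K ⊆ interior (forwardCore F D) :=
    (Metric.self_subset_thickening hr K).trans (interior_maximal
      (fun x hx k => hsub (hrs k hx)) Metric.isOpen_thickening)
  refine ⟨hK.invariant, isClosed_forwardCore hF hD, hint, Subset.antisymm ?_ ?_⟩
  · rw [← hK.maxInvariant_univ]
    exact maxInvariant_mono F (subset_univ _)
  · conv_lhs => rw [← hK.invariant]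
    exact maxInvariant_mono F (hint.trans interior_subset)

/-- The endpoints lie in the images `F^[m n] '' B` of one bounded set, so they approach the compact
set `K`. -/
theorem isAdmissible (hK : IsGlobalAttractor F K) {B : Set Y} (hB : IsClosed B)
    (hb : Bornology.IsBounded B) : IsAdmissible F B := by
  refine ⟨hB, hb, fun x m hm hx => ?_⟩
  refine isCompact_closure_range_of_eventually_mem_thickening hK.isCompact fun ε hε => ?_
  filter_upwards [hm.eventually (hK.attracts B hb ε hε)] with n hn
  exact hn (mem_image_of_mem _ (hx n 0 (Nat.zero_le _)))

end IsGlobalAttractor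

/-- Finite-time shadowing: each step adds the noise to the modulus of continuity of `F`. The
unperturbed orbit is kept in the `u`-neighborhood so that the perturbed one still lies in the `2 *
u`-neighborhood, where the modulus is valid. -/
theorem eventually_dist_iterate_lt {F : Y → Y} {K : Set Y} {u : ℝ} (hu : 0 < u)
    (hF : UniformContinuousOn F (Metric.thickening (2 * u) K)) {G : ℕ → Y → Y} {ε : ℕ → ℝ}
    (hε : Tendsto ε atTop (𝓝 0)) (hG : ∀ n y, dist (G n y) (F y) ≤ ε n) (T : ℕ) :
    ∀ η > 0, ∀ᶠ n in atTop, ∀ y, (∀ j ≤ T, F^[j] y ∈ Metric.thickening u K) →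
      ∀ j ≤ T, dist ((G n)^[j] y) (F^[j] y) < η := by
  induction T with
  | zero =>
    intro η hη
    refine Eventually.of_forall fun n y _ j hj => ?_
    obtain rfl : j = 0 := by omega
    simpa using hη
  | succ T ih =>
    intro η hη
    obtain ⟨δ, hδ, hFδ⟩ := Metric.uniformContinuousOn_iff.1 hF (η / 2) (by positivity)
    filter_upwards [ih (min η (min δ u)) (by positivity),
      hε.eventually (gt_mem_nhds (show (0 : ℝ) < η / 2 by positivity))] with n hn hεn y hy j hj
    have hyT := hn y fun i hi => hy i (by omega)
    rcases Nat.lt_or_ge j (T + 1) with hj' | hj'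
    · exact (hyT j (by omega)).trans_le (min_le_left _ _)
    · obtain rfl : j = T + 1 := by omega
      rw [Function.iterate_succ_apply', Function.iterate_succ_apply']
      have h1 := hyT T le_rfl
      obtain ⟨z, hz, hzd⟩ := Metric.mem_thickening_iff.1 (hy T (by omega))
      have hFu : F^[T] y ∈ Metric.thickening (2 * u) K :=
        Metric.mem_thickening_iff.2 ⟨z, hz, by linarith⟩
      have hGu : (G n)^[T] y ∈ Metric.thickening (2 * u) K := by
        refine Metric.mem_thickening_iff.2 ⟨z, hz, ?_⟩
        have h3 := h1.trans_le ((min_le_right _ _).trans (min_le_right _ _))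
        linarith [dist_triangle ((G n)^[T] y) (F^[T] y) z]
      have h2 := hFδ _ hGu _ hFu (h1.trans_le ((min_le_right _ _).trans (min_le_left _ _)))
      linarith [dist_triangle (G n ((G n)^[T] y)) (F ((G n)^[T] y)) (F (F^[T] y)),
        hG n ((G n)^[T] y)]

/-- Uniformly small perturbations of `F` trap a uniform neighborhood of the attractor, and their
bounded full orbits in the trapping region stay well inside that neighborhood. -/
theorem IsGlobalAttractor.eventually_perturbation {F : Y → Y} {K : Set Y}
    (hK : IsGlobalAttractor F K) (hFc : Continuous F) {u : ℝ} (hu : 0 < u)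
    (hF : UniformContinuousOn F (Metric.thickening (2 * u) K)) {D : Set Y}
    (hDb : Bornology.IsBounded D) (hDu : D ⊆ Metric.thickening u K) {δ : ℝ} (hδ : 0 < δ)
    (hδD : Metric.thickening δ K ⊆ D) {G : ℕ → Y → Y} {ε : ℕ → ℝ}
    (hε : Tendsto ε atTop (𝓝 0)) (hG : ∀ n y, dist (G n y) (F y) ≤ ε n) :
    ∃ r > 0, ∃ n₀, ∀ n ≥ n₀, Metric.thickening r K ⊆ forwardCore (G n) (forwardCore F D) ∧
      maxInvariant (G n) (forwardCore (G n) (forwardCore F D)) ⊆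
        Metric.thickening (r / 2) K := by
  -- `F`-orbits from the `r₁`-neighborhood stay in `D`; those from the `r`-neighborhood stay within
  -- `r₁ / 2` of `K`, leaving `r₁ / 2` of room for the perturbation.
  obtain ⟨r₁, hr₁, hs₁⟩ := hK.stable hFc hδ
  obtain ⟨r, hr, hs⟩ := hK.stable hFc (half_pos hr₁)
  have hB₁ : Metric.thickening r₁ K ⊆ forwardCore F D := fun x hx k => hδD (hs₁ k hx)
  have hB : Metric.thickening r K ⊆ forwardCore F D := fun x hx =>
    hB₁ (Metric.thickening_mono (by linarith) K (hs 0 hx))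
  -- At time `T` attraction leaves a distance `r / 4` and shadowing adds another `r / 4`. `T ≥ 1`
  -- permits division with remainder.
  obtain ⟨T, hT, hT1⟩ := ((hK.attracts D hDb (r / 4) (by positivity)).and
    (eventually_ge_atTop 1)).exists
  obtain ⟨n₀, hn₀⟩ := eventually_atTop.1
    (eventually_dist_iterate_lt hu hF hε hG T (min (r / 4) (r₁ / 2)) (by positivity))
  refine ⟨r, hr, n₀, fun n hn => ?_⟩
  have hclose : ∀ x ∈ forwardCore F D, ∀ j ≤ T,
      dist ((G n)^[j] x) (F^[j] x) < min (r / 4) (r₁ / 2) :=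
    fun x hx => hn₀ n hn x fun j _ => hDu (hx j)
  have hstep : ∀ x ∈ forwardCore F D, (G n)^[T] x ∈ Metric.thickening (r / 2) K := by
    intro x hx
    obtain ⟨z, hz, hzd⟩ := Metric.mem_thickening_iff.1
      (hT (mem_image_of_mem _ (forwardCore_subset F D hx)))
    refine Metric.mem_thickening_iff.2 ⟨z, hz, ?_⟩
    have h1 := (hclose x hx T le_rfl).trans_le (min_le_left _ _)
    linarith [dist_triangle ((G n)^[T] x) (F^[T] x) z]
  have hmaps : MapsTo (G n)^[T] (Metric.thickening r K) (Metric.thickening r K) := fun x hx =>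
    Metric.thickening_mono (by linarith) K (hstep x (hB hx))
  refine ⟨fun x hx k => ?_, ?_⟩
  -- At multiples of `T` the orbit is back in the `r`-neighborhood; shadowing covers the remaining
  -- `k % T` steps.
  · rw [← Nat.mod_add_div k T, Function.iterate_add_apply, Function.iterate_mul]
    have hy := hmaps.iterate (k / T) hx
    set y := ((G n)^[T])^[k / T] x
    have hj : k % T ≤ T := (Nat.mod_lt k (by omega)).le
    obtain ⟨z, hz, hzd⟩ := Metric.mem_thickening_iff.1 (hs (k % T) hy)
    refine hB₁ (Metric.mem_thickening_iff.2 ⟨z, hz, ?_⟩)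
    have h1 := (hclose y (hB hy) _ hj).trans_le (min_le_right _ _)
    linarith [dist_triangle ((G n)^[k % T] y) (F^[k % T] y) z]
  · rintro x ⟨σ, rfl, h1, h2, -⟩
    have := hstep (σ (-T)) (forwardCore_subset _ _ (h1 _))
    rwa [iterate_orbit h2, neg_add_cancel] at this

end Dynamics

/-! ### Invariant sets and limit sets in a weaker compact topology -/

section WeakDynamics

variable {Y : Type*} [MetricSpace Y]

/-- The maximal invariant set of a bounded set that is compact for a weaker Hausdorff topology is
compact for that topology. -/
theorem isCompact_maxInvariant (τ : TopologicalSpace Y) [@T2Space Y τ] {g : Y → Y}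
    (hg : @Continuous Y Y τ τ g) {N : Set Y} (hN : @IsCompact Y τ N)
    (hb : Bornology.IsBounded N) : @IsCompact Y τ (maxInvariant g N) := by
  -- The full orbits form a closed subset of the compact product of copies of `N`.
  have e : maxInvariant g N = (fun σ : ℤ → Y => σ 0) ''
      ((univ.pi fun _ => N) ∩ {σ | ∀ k, g (σ k) = σ (k + 1)}) := by
    ext x
    constructor
    · rintro ⟨σ, h0, h1, h2, -⟩
      exact ⟨σ, ⟨fun k _ => h1 k, h2⟩, h0⟩
    · rintro ⟨σ, ⟨h1, h2⟩, h0⟩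
      exact ⟨σ, h0, fun k => h1 k trivial, h2,
        hb.subset (range_subset_iff.2 fun k => h1 k trivial)⟩
  rw [e]
  let : TopologicalSpace Y := τ
  refine IsCompact.image ?_ (continuous_apply 0)
  refine (isCompact_univ_pi fun _ => hN).inter_right ?_
  rw [ofPred_forall]
  exact isClosed_iInter fun k => isClosed_eq (hg.comp (continuous_apply k)) (continuous_apply _)

/-- The weak `ω`-limit set of a bounded positive invariant set that is compact for a weaker
Hausdorff topology consists of points on full orbits. -/
theorem weakOmega_subset_maxInvariant (τ : TopologicalSpace Y) [@T2Space Y τ] {g : Y → Y}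
    (hg : @Continuous Y Y τ τ g) {N : Set Y} (hN : @IsCompact Y τ N)
    (hb : Bornology.IsBounded N) (hmaps : MapsTo g N N) :
    weakOmega τ g N ⊆ maxInvariant g N := by
  rintro y ⟨x, m, hx, hm, hlim⟩
  let : TopologicalSpace Y := τ
  -- The orbit of `x n`, recentered at time `m n`. `toNat` freezes it before its start, which for
  -- fixed `k` matters only for finitely many `n`.
  let s : ℕ → ℤ → Y := fun n k => g^[((m n : ℤ) + k).toNat] (x n)
  have hs : ∀ n, s n ∈ univ.pi fun _ : ℤ => N := fun n k _ => hmaps.iterate _ (hx n)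
  let 𝒰 : Ultrafilter ℕ := Ultrafilter.of atTop
  have h𝒰 : (𝒰 : Filter ℕ) ≤ atTop := Ultrafilter.of_le _
  obtain ⟨σ, hσN, hσ⟩ := (isCompact_univ_pi fun _ : ℤ => hN).ultrafilter_le_nhds (𝒰.map s)
    (le_principal_iff.2 (Filter.mem_map.2 (Eventually.of_forall hs)))
  have hσk : ∀ k, Tendsto (fun n => s n k) 𝒰 (𝓝 (σ k)) := fun k =>
    ((continuous_apply k).tendsto σ).comp hσ
  refine ⟨σ, ?_, fun k => hσN k trivial, fun k => ?_,
    hb.subset (range_subset_iff.2 fun k => hσN k trivial)⟩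
  · exact tendsto_nhds_unique (hσk 0) (by simpa [s] using hlim.mono_left h𝒰)
  · refine tendsto_nhds_unique (((hg.tendsto _).comp (hσk k)).congr' ?_) (hσk (k + 1))
    filter_upwards [h𝒰 (hm.eventually (eventually_ge_atTop (-k).toNat))] with n hn
    simp only [Function.comp, s]
    rw [← Function.iterate_succ_apply' g]
    congr 2
    omega

end WeakDynamics

/-! ### Mixtures, couplings and the noise estimate -/

section Transport

variable {X : Type*} [MetricSpace X] [MeasurableSpace X]

theorem IsCoupling.isProbabilityMeasure {π : Measure (X × X)} {μ ν : Measure X}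
    [IsProbabilityMeasure μ] (h : IsCoupling π μ ν) : IsProbabilityMeasure π := by
  have : IsProbabilityMeasure (π.map Prod.fst) := by rw [h.1]; infer_instance
  exact Measure.isProbabilityMeasure_of_map Prod.fst

variable [BorelSpace X] [SecondCountableTopology X] {p : ℝ}

theorem toMeasure_mix (t : unitInterval) (μ ν : WassersteinSpace p X) :
    (mix t μ ν).toMeasure = ENNReal.ofReal (t : ℝ) • μ.toMeasure
      + ENNReal.ofReal (1 - (t : ℝ)) • ν.toMeasure := rfl

theorem mix_self (t : unitInterval) (μ : WassersteinSpace p X) : mix t μ μ = μ := by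
  apply WassersteinSpace.toMeasure_injective
  rw [toMeasure_mix, ← add_smul, ← ENNReal.ofReal_add t.2.1 (by linarith [t.2.2])]
  simp

theorem lintegral_mix (t : unitInterval) (μ ν : WassersteinSpace p X) (g : X → ℝ≥0∞) :
    ∫⁻ x, g x ∂(mix t μ ν).toMeasure = ENNReal.ofReal (t : ℝ) * ∫⁻ x, g x ∂μ.toMeasure
      + ENNReal.ofReal (1 - (t : ℝ)) * ∫⁻ x, g x ∂ν.toMeasure := by
  rw [toMeasure_mix, lintegral_add_measure, lintegral_smul_measure, lintegral_smul_measure]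
  rfl

theorem IsCoupling.mix {t : unitInterval} {μ₀ μ₁ ν₀ ν₁ : WassersteinSpace p X}
    {π₀ π₁ : Measure (X × X)} (h₀ : IsCoupling π₀ μ₀.toMeasure ν₀.toMeasure)
    (h₁ : IsCoupling π₁ μ₁.toMeasure ν₁.toMeasure) :
    IsCoupling (ENNReal.ofReal (t : ℝ) • π₀ + ENNReal.ofReal (1 - (t : ℝ)) • π₁)
      (mix t μ₀ μ₁).toMeasure (mix t ν₀ ν₁).toMeasure := by
  constructor
  · rw [Measure.map_add _ _ measurable_fst, Measure.map_smul, Measure.map_smul, h₀.1, h₁.1,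
      toMeasure_mix]
  · rw [Measure.map_add _ _ measurable_snd, Measure.map_smul, Measure.map_smul, h₀.2, h₁.2,
      toMeasure_mix]

theorem cost_add_smul (a b : ℝ≥0∞) (π₀ π₁ : Measure (X × X)) :
    cost p (a • π₀ + b • π₁) = a * cost p π₀ + b * cost p π₁ := by
  rw [cost, lintegral_add_measure, lintegral_smul_measure, lintegral_smul_measure]
  rfl

theorem IsMixtureConvex.preimage {S : Set (WassersteinSpace p X)} (hS : IsMixtureConvex S)
    {g : WassersteinSpace p X → WassersteinSpace p X}
    (hg : ∀ (t : unitInterval) μ ν, g (MarkovWasserstein.mix t μ ν)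
      = MarkovWasserstein.mix t (g μ) (g ν)) :
    IsMixtureConvex (g ⁻¹' S) := by
  intro μ₀ h₀ μ₁ h₁ t
  rw [mem_preimage, hg]
  exact hS _ h₀ _ h₁ t

theorem iterate_mix {g : WassersteinSpace p X → WassersteinSpace p X}
    (hg : ∀ (t : unitInterval) μ ν, g (mix t μ ν) = mix t (g μ) (g ν)) (k : ℕ)
    (t : unitInterval) (μ ν : WassersteinSpace p X) :
    g^[k] (mix t μ ν) = mix t (g^[k] μ) (g^[k] ν) := by
  induction k with
  | zero => rfl
  | succ k ih => rw [Function.iterate_succ_apply', ih, hg, ← Function.iterate_succ_apply' g,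
      ← Function.iterate_succ_apply' g]

theorem IsMixtureConvex.forwardCore {S : Set (WassersteinSpace p X)} (hS : IsMixtureConvex S)
    {g : WassersteinSpace p X → WassersteinSpace p X}
    (hg : ∀ (t : unitInterval) μ ν, g (MarkovWasserstein.mix t μ ν)
      = MarkovWasserstein.mix t (g μ) (g ν)) :
    IsMixtureConvex (forwardCore g S) :=
  fun μ₀ h₀ μ₁ h₁ t k => hS.preimage (iterate_mix hg k) μ₀ (h₀ k) μ₁ (h₁ k) t

theorem IsTransferMap.map_mix {f : X → X} (hf : Measurable f)
    {F : WassersteinSpace p X → WassersteinSpace p X} (hF : IsTransferMap f F)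
    (t : unitInterval) (μ ν : WassersteinSpace p X) :
    F (mix t μ ν) = mix t (F μ) (F ν) := by
  apply WassersteinSpace.toMeasure_injective
  rw [hF, toMeasure_mix, toMeasure_mix, hF, hF, Measure.map_add _ _ hf, Measure.map_smul,
    Measure.map_smul]

variable [CompleteSpace X] [hp : Fact (1 ≤ p)]

theorem ofReal_dist_eq_wEDist (μ ν : WassersteinSpace p X) :
    ENNReal.ofReal (dist μ ν) = wEDist p μ.toMeasure ν.toMeasure := by
  rw [dist_eq_wEDist, ENNReal.ofReal_toReal (wEDist_ne_top hp.out μ ν)]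

theorem dist_le_of_cost_le {μ ν : WassersteinSpace p X} {π : Measure (X × X)}
    (h : IsCoupling π μ.toMeasure ν.toMeasure) {r : ℝ} (hr : 0 ≤ r)
    (hc : cost p π ≤ ENNReal.ofReal r ^ p) : dist μ ν ≤ r := by
  have hp0 : 0 < p := by linarith [hp.out]
  refine (ENNReal.ofReal_le_ofReal_iff hr).1 ?_
  rw [ofReal_dist_eq_wEDist]
  refine (wEDist_le hp.out h).trans ?_
  rwa [one_div, ENNReal.rpow_inv_le_iff hp0]

theorem exists_coupling_cost_le {μ ν : WassersteinSpace p X} {r : ℝ} (h : dist μ ν < r) :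
    ∃ π, IsCoupling π μ.toMeasure ν.toMeasure ∧ cost p π ≤ ENNReal.ofReal r ^ p := by
  have hp0 : 0 < p := by linarith [hp.out]
  have h' : wEDist p μ.toMeasure ν.toMeasure < ENNReal.ofReal r := by
    rw [← ofReal_dist_eq_wEDist]
    exact (ENNReal.ofReal_lt_ofReal_iff (dist_nonneg.trans_lt h)).2 h
  obtain ⟨π, hπ, hc⟩ := exists_coupling_lt hp.out h'
  refine ⟨π, hπ, ?_⟩
  rw [one_div, ENNReal.rpow_inv_lt_iff hp0] at hc
  exact hc.le

/-- The `p`-th power of `w_p` is jointly convex. -/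
theorem dist_mix_rpow_le (t : unitInterval) (μ₀ μ₁ ν₀ ν₁ : WassersteinSpace p X) :
    dist (mix t μ₀ μ₁) (mix t ν₀ ν₁) ^ p
      ≤ t * dist μ₀ ν₀ ^ p + (1 - t) * dist μ₁ ν₁ ^ p := by
  have hp0 : 0 < p := by linarith [hp.out]
  have ht0 : (0 : ℝ) ≤ t := t.2.1
  have ht1 : (0 : ℝ) ≤ 1 - t := by linarith [t.2.2]
  -- The slack `s` replaces optimal plans by near-optimal ones; it tends to zero at the end.
  have key : ∀ s > 0, dist (mix t μ₀ μ₁) (mix t ν₀ ν₁) ^ p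
      ≤ t * (dist μ₀ ν₀ + s) ^ p + (1 - t) * (dist μ₁ ν₁ + s) ^ p := by
    intro s hs
    have ha : 0 ≤ dist μ₀ ν₀ + s := by positivity
    have hb : 0 ≤ dist μ₁ ν₁ + s := by positivity
    obtain ⟨π₀, h₀, c₀⟩ := exists_coupling_cost_le (lt_add_of_pos_right (dist μ₀ ν₀) hs)
    obtain ⟨π₁, h₁, c₁⟩ := exists_coupling_cost_le (lt_add_of_pos_right (dist μ₁ ν₁) hs)
    set c := (t : ℝ) * (dist μ₀ ν₀ + s) ^ p + (1 - t) * (dist μ₁ ν₁ + s) ^ p with hc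
    have hc0 : 0 ≤ c := by positivity
    have := dist_le_of_cost_le (h₀.mix (t := t) h₁) (r := c ^ (1 / p)) (by positivity) (by
      rw [cost_add_smul, ENNReal.ofReal_rpow_of_nonneg (by positivity) hp0.le,
        ← Real.rpow_mul hc0, one_div_mul_cancel hp0.ne', Real.rpow_one, hc,
        ENNReal.ofReal_add (by positivity) (by positivity), ENNReal.ofReal_mul ht0,
        ENNReal.ofReal_mul ht1, ← ENNReal.ofReal_rpow_of_nonneg ha hp0.le,
        ← ENNReal.ofReal_rpow_of_nonneg hb hp0.le]
      gcongr)
    have h2 := Real.rpow_le_rpow dist_nonneg this hp0.le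
    rwa [← Real.rpow_mul hc0, one_div_mul_cancel hp0.ne', Real.rpow_one] at h2
  have hcont : Tendsto (fun s : ℝ => t * (dist μ₀ ν₀ + s) ^ p + (1 - t) * (dist μ₁ ν₁ + s) ^ p)
      (𝓝[>] 0) (𝓝 (t * (dist μ₀ ν₀ + 0) ^ p + (1 - t) * (dist μ₁ ν₁ + 0) ^ p)) := by
    refine (Continuous.tendsto ?_ 0).mono_left nhdsWithin_le_nhds
    have h1 : ∀ a : ℝ, Continuous fun s : ℝ => (a + s) ^ p := fun a =>
      (continuous_const.add continuous_id).rpow_const fun _ => Or.inr hp0.le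
    exact (continuous_const.mul (h1 _)).add (continuous_const.mul (h1 _))
  simp only [add_zero] at hcont
  exact ge_of_tendsto hcont (eventually_mem_nhdsWithin.mono fun s hs => key s hs)

/-- The `ν`-part stays in place, so only a fraction `t` of the mass pays. -/
theorem dist_mix_right_rpow_le (t : unitInterval) (μ ν : WassersteinSpace p X) :
    dist (mix t μ ν) ν ^ p ≤ t * dist μ ν ^ p := by
  have hp0 : p ≠ 0 := by linarith [hp.out]
  have := dist_mix_rpow_le t μ ν ν ν
  rwa [mix_self, dist_self, Real.zero_rpow hp0, mul_zero, add_zero] at this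

theorem dist_mix_left_rpow_le (t : unitInterval) (μ ν : WassersteinSpace p X) :
    dist (mix t μ ν) μ ^ p ≤ (1 - t) * dist ν μ ^ p := by
  have hp0 : p ≠ 0 := by linarith [hp.out]
  have := dist_mix_rpow_le t μ ν μ μ
  rwa [mix_self, dist_self, Real.zero_rpow hp0, mul_zero, zero_add] at this

/-- The second coordinate is almost surely `a`, so the plan leaves no choice. -/
theorem IsCoupling.cost_dirac {π : Measure (X × X)} {μ : Measure X} {a : X}
    (h : IsCoupling π μ (Measure.dirac a)) : cost p π = ∫⁻ x, edist x a ^ p ∂μ := by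
  have hae : ∀ᵐ z ∂π, z.2 = a := by
    have h1 : ∀ᵐ y ∂(π.map Prod.snd), y = a := by
      rw [h.2, ae_dirac_eq]; rfl
    exact ae_of_ae_map measurable_snd.aemeasurable h1
  have hm : Measurable fun x : X => edist x a ^ p := by fun_prop
  rw [← h.1, lintegral_map hm measurable_fst, cost]
  refine lintegral_congr_ae ?_
  filter_upwards [hae] with z hz
  rw [hz]

/-- `w_p(μ, δ_a)` is the `p`-th root of the `p`-th moment of `μ` about `a`. -/
theorem lintegral_edist_rpow (μ : WassersteinSpace p X) (a : X) :
    ∫⁻ x, edist x a ^ p ∂μ.toMeasure = ENNReal.ofReal (dist μ (diracW p a)) ^ p := by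
  have hp0 : 0 < p := by linarith [hp.out]
  refine le_antisymm ?_ ?_
  · rw [ofReal_dist_eq_wEDist, wEDist, ← ENNReal.rpow_mul, one_div_mul_cancel hp0.ne',
      ENNReal.rpow_one]
    exact le_iInf₂ fun π hπ => (IsCoupling.cost_dirac hπ).ge
  · rw [dist_comm, ofReal_dist_eq_wEDist, ← ENNReal.le_rpow_inv_iff hp0, ← one_div]
    refine (wEDist_dirac_le hp.out a μ.toMeasure).trans_eq ?_
    simp_rw [edist_comm a]

theorem dist_diracW_le (a b : X) : dist (diracW p a) (diracW p b) ≤ dist a b := by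
  have hp0 : 0 < p := by linarith [hp.out]
  have h := lintegral_edist_rpow (diracW p a) b
  have e : (diracW p a).toMeasure = Measure.dirac a := rfl
  rw [e, lintegral_dirac] at h
  have h' := ENNReal.rpow_left_injective hp0.ne' h
  rw [edist_dist] at h'
  exact (ENNReal.ofReal_le_ofReal_iff dist_nonneg).1 h'.ge

theorem continuous_diracW : Continuous (diracW p : X → WassersteinSpace p X) :=
  (LipschitzWith.of_dist_le' (K := 1) fun a b => by
    simpa using dist_diracW_le (p := p) a b).continuous

namespace IsMWMap

variable {f : X → X} {M : ℝ} {P F : WassersteinSpace p X → WassersteinSpace p X}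

/-- A Markov-Wasserstein map with noise level `M` is uniformly `M`-close to the transfer map. -/
theorem dist_le (hP : IsMWMap f M P) (hf : Measurable f) (hF : IsTransferMap f F)
    (μ : WassersteinSpace p X) : dist (P μ) (F μ) ≤ M := by
  have hp0 : 0 < p := by linarith [hp.out]
  obtain ⟨κ, hκm, hκ, hM⟩ := hP.kernel
  obtain ⟨x₀⟩ : Nonempty X := nonempty_of_isProbabilityMeasure μ.toMeasure
  have hM0 : 0 ≤ M := dist_nonneg.trans (hM x₀)
  let k : ProbabilityTheory.Kernel X X := ⟨fun x => (κ x).toMeasure, hκm⟩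
  have : ProbabilityTheory.IsMarkovKernel k :=
    ⟨fun x => inferInstanceAs (IsProbabilityMeasure (κ x).toMeasure)⟩
  -- If `x` has law `μ` and `y` is drawn from the kernel at `x`, then `(y, f x)` couples `P μ` with
  -- `F μ`.
  have hm : Measurable fun z : X × X => (z.2, f z.1) := by fun_prop
  have hc : IsCoupling ((μ.toMeasure.compProd k).map fun z => (z.2, f z.1)) (P μ).toMeasure
      (F μ).toMeasure := by
    constructor
    · rw [Measure.map_map measurable_fst hm, hκ]
      exact Measure.snd_compProd μ.toMeasure k
    · rw [Measure.map_map measurable_snd hm, hF]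
      have : (Prod.snd ∘ fun z : X × X => (z.2, f z.1)) = f ∘ Prod.fst := rfl
      rw [this, ← Measure.map_map hf measurable_fst]
      congr 1
      exact Measure.fst_compProd μ.toMeasure k
  refine dist_le_of_cost_le hc hM0 ?_
  have hm' : Measurable fun z : X × X => edist z.2 (f z.1) ^ p :=
    (measurable_cost_integrand p).comp hm
  rw [cost, lintegral_map (measurable_cost_integrand p) hm]
  dsimp only
  rw [Measure.lintegral_compProd hm']
  calc ∫⁻ x, ∫⁻ y, edist y (f x) ^ p ∂(k x) ∂μ.toMeasure
      ≤ ∫⁻ _, ENNReal.ofReal M ^ p ∂μ.toMeasure := by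
        refine lintegral_mono fun x => ?_
        refine (lintegral_edist_rpow (κ x) (f x)).trans_le ?_
        exact ENNReal.rpow_le_rpow (ENNReal.ofReal_le_ofReal (hM x)) hp0.le
    _ = ENNReal.ofReal M ^ p := by simp

end IsMWMap

end Transport

/-! ### Tightness from moments -/

section Tightness

/-- Probability measures on a proper space with uniformly bounded `p`-th moments are tight. -/
theorem isTightMeasureSet_of_lintegral_edist_rpow_le {E : Type*} [PseudoMetricSpace E]
    [ProperSpace E] [MeasurableSpace E] [OpensMeasurableSpace E] {p : ℝ} (hp : 0 < p) (z₀ : E)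
    {C : ℝ≥0∞} (hC : C ≠ ∞) {S : Set (Measure E)}
    (h : ∀ π ∈ S, ∫⁻ z, edist z z₀ ^ p ∂π ≤ C) : IsTightMeasureSet S := by
  rw [isTightMeasureSet_iff_exists_isCompact_measure_compl_le]
  intro ε hε
  by_cases hεt : ε = ∞
  · exact ⟨∅, isCompact_empty, fun π _ => hεt ▸ le_top⟩
  -- Markov's inequality needs `C / R ≤ ε`; the added 1 keeps `R` nonzero.
  set R : ℝ≥0∞ := (C + 1) / ε with hR
  have hR0 : R ≠ 0 := (ENNReal.div_pos (by simp) hεt).ne'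
  have hRt : R ≠ ∞ := ENNReal.div_ne_top (by simp [hC]) hε.ne'
  refine ⟨Metric.closedBall z₀ (R ^ p⁻¹).toReal, isCompact_closedBall _ _, fun π hπ => ?_⟩
  have hm : AEMeasurable (fun z => edist z z₀ ^ p) π := by fun_prop
  refine (measure_mono (t := {z | R ≤ edist z z₀ ^ p}) ?_).trans
    ((meas_ge_le_lintegral_div hm hR0 hRt).trans ?_)
  · intro z hz
    by_contra hcon
    refine hz ?_
    have h1 : edist z z₀ ≤ R ^ p⁻¹ := (ENNReal.le_rpow_inv_iff hp).2 (not_le.1 hcon).le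
    rw [Metric.mem_closedBall, dist_edist]
    exact ENNReal.toReal_mono (ENNReal.rpow_ne_top_of_nonneg (by positivity) hRt) h1
  · refine ENNReal.div_le_of_le_mul ((h π hπ).trans ?_)
    rw [hR, ENNReal.mul_div_cancel hε.ne' hεt]
    exact le_self_add

end Tightness

/-! ### The weak topology compared with w_p -/

section WeakTopology

variable {X : Type*} [MetricSpace X] [MeasurableSpace X] [BorelSpace X]
  [SecondCountableTopology X] {p : ℝ}

/-- Transport plans of bounded cost form a weakly closed set. -/
theorem isClosed_setOf_cost_le (hp : 0 ≤ p) (c : ℝ≥0∞) :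
    IsClosed {π : ProbabilityMeasure (X × X) | cost p (π : Measure (X × X)) ≤ c} := by
  -- Truncating the integrand at height `m` exhibits the cost as a supremum of weakly continuous
  -- functions.
  let g : ℕ → BoundedContinuousFunction (X × X) NNReal := fun m =>
    BoundedContinuousFunction.mkOfBound
      ⟨fun z => min (nndist z.1 z.2 ^ p) m, by
        refine Continuous.min ?_ continuous_const
        exact (NNReal.continuous_rpow_const hp).comp continuous_nndist⟩ m (by
        intro x y
        rw [NNReal.dist_eq, abs_sub_le_iff]
        have h1 : ∀ z : X × X, ((min (nndist z.1 z.2 ^ p) (m : NNReal) : NNReal) : ℝ) ≤ m :=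
          fun z => by exact_mod_cast min_le_right _ _
        constructor
        · exact (sub_le_self _ (NNReal.coe_nonneg _)).trans (h1 x)
        · exact (sub_le_self _ (NNReal.coe_nonneg _)).trans (h1 y))
  have hg : ∀ m z, (g m z : ℝ≥0∞) = min (edist z.1 z.2 ^ p) m := by
    intro m z
    change ((min (nndist z.1 z.2 ^ p) (m : NNReal) : NNReal) : ℝ≥0∞) = _
    rw [ENNReal.coe_min, ENNReal.coe_rpow_of_nonneg _ hp, edist_nndist]
    simp
  have hcost : ∀ π : Measure (X × X), cost p π = ⨆ m, ∫⁻ z, g m z ∂π := by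
    intro π
    rw [← lintegral_iSup]
    · refine lintegral_congr fun z => ?_
      simp_rw [hg]
      rw [← inf_iSup_eq, ENNReal.iSup_natCast, inf_top_eq]
    · exact fun m => (g m).continuous.measurable.coe_nnreal_ennreal
    · intro m n hmn z
      simp only [hg]
      gcongr
  have e : {π : ProbabilityMeasure (X × X) | cost p (π : Measure (X × X)) ≤ c}
      = ⋂ m, {π : ProbabilityMeasure (X × X) | ∫⁻ z, g m z ∂(π : Measure (X × X)) ≤ c} := by
    ext π
    simp [hcost]
  rw [e]
  exact isClosed_iInter fun m => isClosed_le
    (ProbabilityMeasure.continuous_lintegral_boundedContinuousFunction (g m)) continuous_const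

instance : @T2Space (WassersteinSpace p X) (weakTopology p X) := by
  let := weakTopology p X
  refine T2Space.of_injective_continuous (f := WassersteinSpace.toProb) ?_ continuous_induced_dom
  intro μ ν h
  exact WassersteinSpace.toMeasure_injective (congrArg (fun q : ProbabilityMeasure X => (q : Measure X)) h)

theorem continuous_weak_lintegral (g : BoundedContinuousFunction X NNReal) :
    @Continuous _ _ (weakTopology p X) _
      fun μ : WassersteinSpace p X => ∫⁻ x, g x ∂μ.toMeasure := by
  let := weakTopology p X
  exact (ProbabilityMeasure.continuous_lintegral_boundedContinuousFunction g).comp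
    (continuous_induced_dom (f := WassersteinSpace.toProb (p := p) (X := X)))

theorem continuous_weak_of_forall_lintegral
    {G : WassersteinSpace p X → WassersteinSpace p X}
    (h : ∀ g : BoundedContinuousFunction X NNReal, @Continuous _ _ (weakTopology p X) _
      fun μ : WassersteinSpace p X => ∫⁻ x, g x ∂(G μ).toMeasure) :
    @Continuous _ _ (weakTopology p X) (weakTopology p X) G := by
  let := weakTopology p X
  exact continuous_induced_rng.2 (ProbabilityMeasure.continuous_iff_forall_continuous_lintegral.2 h)

theorem IsTransferMap.continuous_weak {f : X → X} (hf : Continuous f)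
    {F : WassersteinSpace p X → WassersteinSpace p X} (hF : IsTransferMap f F) :
    @Continuous _ _ (weakTopology p X) (weakTopology p X) F := by
  refine continuous_weak_of_forall_lintegral fun g => ?_
  convert continuous_weak_lintegral (p := p) (g.compContinuous ⟨f, hf⟩) using 2 with μ
  rw [hF, lintegral_map g.continuous.measurable.coe_nnreal_ennreal hf.measurable]
  rfl

theorem toMeasure_eq_of_forall_lintegral_eq {μ ν : WassersteinSpace p X}
    (h : ∀ g : BoundedContinuousFunction X NNReal,
      ∫⁻ x, g x ∂μ.toMeasure = ∫⁻ x, g x ∂ν.toMeasure) : μ = ν :=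
  WassersteinSpace.toMeasure_injective (ext_of_forall_lintegral_eq_of_IsFiniteMeasure h)

/-- By Markov's inequality a plan of cost at most `ε ^ p * ε` moves at most mass `ε` by a distance
`ε` or more. -/
theorem levyProkhorovEDist_le_of_wEDist_lt (hp : 1 ≤ p) {μ ν : Measure X}
    [IsProbabilityMeasure μ] [IsProbabilityMeasure ν] {δ : ℝ≥0∞}
    (h : wEDist p μ ν < δ * δ ^ (1 / p)) : levyProkhorovEDist μ ν ≤ δ := by
  have hp0 : 0 < p := by linarith
  refine levyProkhorovEDist_le_of_forall_le μ ν δ fun ε B hδε hεt hB => ?_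
  have hε : 0 < ε := hδε.pos
  obtain ⟨π, hc, hπ⟩ := exists_coupling_lt hp
    (h.trans_le (mul_le_mul' hδε.le (ENNReal.rpow_le_rpow hδε.le (by positivity))))
  have hcost : cost p π ≤ ε ^ p * ε := by
    have := ENNReal.rpow_le_rpow hπ.le hp0.le
    rwa [← ENNReal.rpow_mul, one_div, inv_mul_cancel₀ hp0.ne', ENNReal.rpow_one,
      ENNReal.mul_rpow_of_nonneg _ _ hp0.le, ← ENNReal.rpow_mul, inv_mul_cancel₀ hp0.ne',
      ENNReal.rpow_one] at this
  have hmk : π {z | ε ^ p ≤ edist z.1 z.2 ^ p} ≤ ε :=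
    (ENNReal.mul_le_mul_iff_right (ENNReal.rpow_pos hε hεt.ne).ne'
      (ENNReal.rpow_ne_top_of_nonneg hp0.le hεt.ne)).1
      ((mul_meas_ge_le_lintegral (measurable_cost_integrand p) (ε ^ p)).trans hcost)
  rw [← hc.1, ← hc.2, Measure.map_apply measurable_fst hB,
    Measure.map_apply measurable_snd Metric.isOpen_thickening.measurableSet]
  refine (measure_mono fun z hz => ?_).trans
    ((measure_union_le _ _).trans (add_le_add le_rfl hmk))
  by_cases hd : ε ^ p ≤ edist z.1 z.2 ^ p
  · exact Or.inr hd
  · refine Or.inl (Metric.mem_thickening_iff.2 ⟨z.1, hz, ?_⟩)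
    rw [dist_comm, dist_edist]
    exact (ENNReal.toReal_lt_toReal (edist_ne_top _ _) hεt.ne).2
      ((ENNReal.rpow_lt_rpow_iff hp0).1 (not_le.1 hd))

variable [CompleteSpace X] [hp : Fact (1 ≤ p)]

/-- Convergence in `w_p` implies weak convergence. -/
theorem continuous_toProb :
    Continuous (WassersteinSpace.toProb : WassersteinSpace p X → ProbabilityMeasure X) := by
  have hLP : Continuous fun μ : WassersteinSpace p X => LevyProkhorov.ofMeasure μ.toProb := by
    refine Metric.continuous_iff.2 fun ν ε hε => ?_
    have hc : (0 : ℝ) < ε / 2 := by positivity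
    refine ⟨ε / 2 * (ε / 2) ^ (1 / p), by positivity, fun μ hμ => ?_⟩
    refine lt_of_le_of_lt ?_ (half_lt_self hε)
    rw [LevyProkhorov.dist_probabilityMeasure_def]
    refine ENNReal.toReal_le_of_le_ofReal hc.le ?_
    refine levyProkhorovEDist_le_of_wEDist_lt (μ := μ.toMeasure) (ν := ν.toMeasure) hp.out ?_
    rw [← ofReal_dist_eq_wEDist, ENNReal.ofReal_rpow_of_pos hc, ← ENNReal.ofReal_mul hc.le]
    exact (ENNReal.ofReal_lt_ofReal_iff (by positivity)).2 hμ
  exact LevyProkhorov.continuous_toMeasure_probabilityMeasure.comp hLP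

theorem isClosed_of_isClosed_weak {S : Set (WassersteinSpace p X)}
    (hS : @IsClosed _ (weakTopology p X) S) : IsClosed S :=
  hS.mono (continuous_iff_le_induced.1 continuous_toProb)

end WeakTopology

/-! ### Weak continuity of Markov-Wasserstein maps -/

section Feller

variable {X : Type*} [MetricSpace X] [MeasurableSpace X] [BorelSpace X]
  [SecondCountableTopology X] [CompleteSpace X] {p : ℝ} [hp : Fact (1 ≤ p)]
  {f : X → X} {M : ℝ} {P : WassersteinSpace p X → WassersteinSpace p X}

namespace IsMWMap

/-- The dual action of a Markov-Wasserstein map on bounded continuous functions. -/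
theorem exists_dual (hP : IsMWMap f M P) (g : BoundedContinuousFunction X NNReal) :
    ∃ h : BoundedContinuousFunction X NNReal, ∀ μ : WassersteinSpace p X,
      ∫⁻ x, g x ∂(P μ).toMeasure = ∫⁻ x, h x ∂μ.toMeasure := by
  obtain ⟨κ, hκm, hκ, -⟩ := hP.kernel
  -- The kernel is read off from point masses, so continuity of `P` for w_p makes it weakly
  -- continuous in `x`.
  have hκP : ∀ x, κ x = P (diracW p x) := fun x => by
    apply WassersteinSpace.toMeasure_injective
    rw [hκ]
    exact (Measure.dirac_bind hκm x).symm
  have hcont : Continuous fun x => (κ x).toProb := by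
    simp_rw [hκP]
    exact continuous_toProb.comp (hP.continuous.comp continuous_diracW)
  let h : BoundedContinuousFunction X NNReal := BoundedContinuousFunction.mkOfBound
    ⟨fun x => (κ x).toProb.toFiniteMeasure.testAgainstNN g,
      (ProbabilityMeasure.continuous_testAgainstNN_eval g).comp hcont⟩ (nndist g 0) (by
      have hb : ∀ x, (κ x).toProb.toFiniteMeasure.testAgainstNN g ≤ nndist g 0 := fun x => by
        simpa using (κ x).toProb.toFiniteMeasure.testAgainstNN_lipschitz_estimate g 0
      intro x y
      rw [NNReal.dist_eq, abs_sub_le_iff]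
      exact ⟨(sub_le_self _ (NNReal.coe_nonneg _)).trans (NNReal.coe_le_coe.2 (hb x)),
        (sub_le_self _ (NNReal.coe_nonneg _)).trans (NNReal.coe_le_coe.2 (hb y))⟩)
  refine ⟨h, fun μ => ?_⟩
  rw [hκ, Measure.lintegral_bind hκm.aemeasurable
    g.continuous.measurable.coe_nnreal_ennreal.aemeasurable]
  refine lintegral_congr fun x => ?_
  exact (FiniteMeasure.testAgainstNN_coe_eq (μ := (κ x).toProb.toFiniteMeasure) (f := g)).symm

theorem continuous_weak (hP : IsMWMap f M P) :
    @Continuous _ _ (weakTopology p X) (weakTopology p X) P := by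
  refine continuous_weak_of_forall_lintegral fun g => ?_
  obtain ⟨h, hh⟩ := hP.exists_dual g
  simp_rw [hh]
  exact continuous_weak_lintegral h

end IsMWMap

end Feller

theorem isCompact_forwardCore {Y : Type*} [TopologicalSpace Y] [T2Space Y] {g : Y → Y}
    (hg : Continuous g) {D : Set Y} (hD : IsCompact D) : IsCompact (forwardCore g D) :=
  hD.of_isClosed_subset (isClosed_forwardCore hg hD.isClosed) (forwardCore_subset g D)

/-! ### Convex, weakly compact tubes -/

section CouplingNhd

variable {X : Type*} [MetricSpace X] [MeasurableSpace X] {p : ℝ}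

/-- The measures that can be reached from `K` by a transport plan of cost at most `c`. -/
def couplingNhd (K : Set (WassersteinSpace p X)) (c : ℝ≥0∞) : Set (WassersteinSpace p X) :=
  {μ | ∃ ν ∈ K, ∃ π, IsCoupling π ν.toMeasure μ.toMeasure ∧ cost p π ≤ c}

variable [BorelSpace X] [SecondCountableTopology X]

/-- Mixing plans mixes both marginals, and the cost is linear in the plan. -/
theorem IsMixtureConvex.couplingNhd {K : Set (WassersteinSpace p X)} (hK : IsMixtureConvex K)
    (c : ℝ≥0∞) : IsMixtureConvex (couplingNhd K c) := by
  rintro μ₀ ⟨ν₀, hν₀, π₀, h₀, c₀⟩ μ₁ ⟨ν₁, hν₁, π₁, h₁, c₁⟩ t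
  refine ⟨MarkovWasserstein.mix t ν₀ ν₁, hK _ hν₀ _ hν₁ t, _, h₀.mix h₁, ?_⟩
  rw [cost_add_smul]
  refine (add_le_add (mul_le_mul' le_rfl c₀) (mul_le_mul' le_rfl c₁)).trans_eq ?_
  rw [← add_mul, ← ENNReal.ofReal_add t.2.1 (by linarith [t.2.2])]
  simp

variable [CompleteSpace X] [hp : Fact (1 ≤ p)]

theorem thickening_subset_couplingNhd (K : Set (WassersteinSpace p X)) (δ : ℝ) :
    Metric.thickening δ K ⊆ couplingNhd K (ENNReal.ofReal δ ^ p) := by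
  intro μ hμ
  obtain ⟨ν, hν, hd⟩ := Metric.mem_thickening_iff.1 hμ
  obtain ⟨π, hπ, hc⟩ := exists_coupling_cost_le (dist_comm μ ν ▸ hd)
  exact ⟨ν, hν, π, hπ, hc⟩

theorem couplingNhd_subset_thickening (K : Set (WassersteinSpace p X)) {δ u : ℝ} (hδ : 0 ≤ δ)
    (hu : δ < u) : couplingNhd K (ENNReal.ofReal δ ^ p) ⊆ Metric.thickening u K := by
  rintro μ ⟨ν, hν, π, hπ, hc⟩
  refine Metric.mem_thickening_iff.2 ⟨ν, hν, ?_⟩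
  rw [dist_comm]
  exact (dist_le_of_cost_le hπ hδ hc).trans_lt hu

/-- The `p`-th moment of a transport plan is controlled by a marginal and by the cost. -/
theorem lintegral_edist_prod_rpow_le (a : X) {π : Measure (X × X)} {ν : Measure X}
    (h : π.map Prod.fst = ν) :
    ∫⁻ z, edist z (a, a) ^ p ∂π ≤ 2 ^ (p - 1) * (∫⁻ x, edist x a ^ p ∂ν + cost p π) := by
  have hp0 : 0 < p := by linarith [hp.out]
  have hm : Measurable fun x : X => edist x a ^ p := by fun_prop
  have hm' : Measurable fun z : X × X => edist z.1 a ^ p := by fun_prop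
  have hm₂ : Measurable fun z : X × X => edist z.1 a ^ p + edist z.1 z.2 ^ p :=
    hm'.add (measurable_cost_integrand p)
  rw [← h, lintegral_map hm measurable_fst, cost, ← lintegral_add_left hm',
    ← lintegral_const_mul _ hm₂]
  refine lintegral_mono fun z => ?_
  refine le_trans (ENNReal.rpow_le_rpow ?_ hp0.le)
    (ENNReal.rpow_add_le_mul_rpow_add_rpow _ _ hp.out)
  rw [Prod.edist_eq]
  refine max_le le_self_add ?_
  rw [add_comm, edist_comm z.1 z.2]
  exact edist_triangle _ _ _

variable [ProperSpace X]

/-- The tube is the image, under the second marginal, of the plans with first marginal in `K` and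
cost at most `c`. These plans form a weakly closed set with bounded moments, hence a compact one by
Prokhorov's theorem. -/
theorem isCompact_weak_couplingNhd {K : Set (WassersteinSpace p X)} (hK : IsCompact K)
    {c : ℝ≥0∞} (hc : c ≠ ∞) :
    @IsCompact _ (weakTopology p X) (couplingNhd K c) := by
  have hp0 : 0 < p := by linarith [hp.out]
  rcases K.eq_empty_or_nonempty with rfl | ⟨μ₀, -⟩
  · have : couplingNhd (∅ : Set (WassersteinSpace p X)) c = ∅ := by
      simp [couplingNhd]
    rw [this]
    exact @isCompact_empty _ (weakTopology p X)
  obtain ⟨a⟩ : Nonempty X := nonempty_of_isProbabilityMeasure μ₀.toMeasure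
  obtain ⟨R, hR⟩ := hK.isBounded.subset_closedBall (diracW p a)
  have hmom : ∀ ν ∈ K, ∫⁻ x, edist x a ^ p ∂ν.toMeasure ≤ ENNReal.ofReal R ^ p := by
    intro ν hν
    rw [lintegral_edist_rpow]
    exact ENNReal.rpow_le_rpow (ENNReal.ofReal_le_ofReal (hR hν)) hp0.le
  set C : ℝ≥0∞ := 2 ^ (p - 1) * (ENNReal.ofReal R ^ p + c) with hC
  have hCt : C ≠ ∞ := ENNReal.mul_ne_top
    (ENNReal.rpow_ne_top_of_nonneg (by linarith [hp.out]) (by simp))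
    (ENNReal.add_ne_top.2 ⟨ENNReal.rpow_ne_top_of_nonneg hp0.le ENNReal.ofReal_ne_top, hc⟩)
  let fstP : ProbabilityMeasure (X × X) → ProbabilityMeasure X := fun π =>
    π.map (continuous_fst.measurable.aemeasurable)
  let sndP : ProbabilityMeasure (X × X) → ProbabilityMeasure X := fun π =>
    π.map (continuous_snd.measurable.aemeasurable)
  have hfst : Continuous fstP := ProbabilityMeasure.continuous_map continuous_fst
  have hsnd : Continuous sndP := ProbabilityMeasure.continuous_map continuous_snd
  let S : Set (ProbabilityMeasure (X × X)) := fstP ⁻¹' (WassersteinSpace.toProb '' K) ∩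
    {π | cost p (π : Measure (X × X)) ≤ c}
  have hSmom : ∀ π ∈ S, ∫⁻ z, edist z (a, a) ^ p ∂(π : Measure (X × X)) ≤ C := by
    rintro π ⟨⟨ν, hν, he⟩, hcost⟩
    have he' : (π : Measure (X × X)).map Prod.fst = ν.toMeasure :=
      (congrArg (fun q : ProbabilityMeasure X => (q : Measure X)) he).symm
    refine (lintegral_edist_prod_rpow_le a he').trans ?_
    exact mul_le_mul' le_rfl (add_le_add (hmom ν hν) hcost)
  have hSclosed : IsClosed S :=
    ((hK.image continuous_toProb).isClosed.preimage hfst).inter (isClosed_setOf_cost_le hp0.le c)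
  have hScompact : IsCompact S := by
    rw [← hSclosed.closure_eq]
    refine isCompact_closure_of_isTightMeasureSet
      (isTightMeasureSet_of_lintegral_edist_rpow_le hp0 (a, a) hCt ?_)
    rintro _ ⟨π, hπ, rfl⟩
    exact hSmom π hπ
  have himage : WassersteinSpace.toProb '' couplingNhd K c = sndP '' S := by
    apply Subset.antisymm
    · rintro _ ⟨μ, ⟨ν, hν, π, hπ, hcost⟩, rfl⟩
      refine ⟨⟨π, hπ.isProbabilityMeasure⟩, ⟨⟨ν, hν, ?_⟩, hcost⟩, ?_⟩
      · exact Subtype.ext hπ.1.symm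
      · exact Subtype.ext hπ.2
    · rintro _ ⟨π, hπ, rfl⟩
      -- The moment bound on the plan ensures that its second marginal belongs to the Wasserstein
      -- space.
      have hb : ∫⁻ x, edist x a ^ p ∂(sndP π : Measure X) < ∞ := by
        refine lt_of_le_of_lt ?_ ((hSmom π hπ).trans_lt hCt.lt_top)
        have hm : Measurable fun x : X => edist x a ^ p := by fun_prop
        change ∫⁻ x, edist x a ^ p ∂((π : Measure (X × X)).map Prod.snd) ≤ _
        rw [lintegral_map hm measurable_snd]
        refine lintegral_mono fun z => ENNReal.rpow_le_rpow ?_ hp0.le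
        exact le_max_right (edist z.1 a) (edist z.2 a)
      have hmoment : ∀ x₀ : X, ∫⁻ x, edist x₀ x ^ p ∂(sndP π : Measure X) < ∞ := by
        intro x₀
        have hle : ∀ x, edist x₀ x ^ p ≤ 2 ^ (p - 1) * (edist x₀ a ^ p + edist x a ^ p) :=
          fun x => (ENNReal.rpow_le_rpow (edist_comm x a ▸ edist_triangle x₀ a x) hp0.le).trans
            (ENNReal.rpow_add_le_mul_rpow_add_rpow _ _ hp.out)
        refine (lintegral_mono hle).trans_lt ?_
        rw [lintegral_const_mul' _ _
          (ENNReal.rpow_ne_top_of_nonneg (by linarith [hp.out]) (by simp)),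
          lintegral_add_left measurable_const, lintegral_const, measure_univ, mul_one]
        exact ENNReal.mul_lt_top
          (ENNReal.rpow_lt_top_of_nonneg (by linarith [hp.out]) (by simp))
          (ENNReal.add_lt_top.2
            ⟨ENNReal.rpow_lt_top_of_nonneg hp0.le (edist_ne_top _ _), hb⟩)
      obtain ⟨⟨ν, hν, he⟩, hcost⟩ := hπ
      exact ⟨⟨sndP π, hmoment⟩, ⟨ν, hν, π,
        ⟨(congrArg (fun q : ProbabilityMeasure X => (q : Measure X)) he).symm, rfl⟩, hcost⟩, rfl⟩
  let := weakTopology p X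
  have hind : IsInducing (WassersteinSpace.toProb : WassersteinSpace p X → _) := ⟨rfl⟩
  rw [hind.isCompact_iff, himage]
  exact hScompact.image hsnd

end CouplingNhd

/-! ### Bounded orbits of affine maps -/

section Affine

variable {X : Type*} [MetricSpace X] [MeasurableSpace X] [BorelSpace X]
  [SecondCountableTopology X] [CompleteSpace X] {p : ℝ} [hp : Fact (1 ≤ p)]

theorem isMixtureConvex_closedBall (μ : WassersteinSpace p X) (R : ℝ) :
    IsMixtureConvex (Metric.closedBall μ R) := by
  have hp0 : 0 < p := by linarith [hp.out]
  intro μ₀ h₀ μ₁ h₁ t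
  rw [Metric.mem_closedBall] at *
  have hR : 0 ≤ R := dist_nonneg.trans h₀
  have ht1 : (0 : ℝ) ≤ 1 - t := by linarith [t.2.2]
  have h := dist_mix_rpow_le t μ₀ μ₁ μ μ
  rw [mix_self] at h
  refine (Real.rpow_le_rpow_iff dist_nonneg hR hp0).1 (h.trans ?_)
  have e₀ := mul_le_mul_of_nonneg_left (Real.rpow_le_rpow dist_nonneg h₀ hp0.le) t.2.1
  have e₁ := mul_le_mul_of_nonneg_left (Real.rpow_le_rpow dist_nonneg h₁ hp0.le) ht1
  linarith

variable {g : WassersteinSpace p X → WassersteinSpace p X}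

/-- Mixing two full orbits timewise gives a full orbit, bounded because balls are convex. -/
theorem isMixtureConvex_maxInvariant_univ
    (hg : ∀ (t : unitInterval) μ ν, g (mix t μ ν) = mix t (g μ) (g ν)) :
    IsMixtureConvex (maxInvariant g univ) := by
  rintro _ ⟨σ, rfl, -, hσ, hσb⟩ _ ⟨τ, rfl, -, hτ, hτb⟩ t
  obtain ⟨R, hR⟩ := (hσb.union hτb).subset_closedBall (σ 0)
  refine ⟨fun k => mix t (σ k) (τ k), rfl, fun _ => trivial,
    fun k => by rw [hg, hσ, hτ], (Metric.isBounded_closedBall (x := σ 0) (r := R)).subset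
      (range_subset_iff.2 fun k => ?_)⟩
  exact isMixtureConvex_closedBall (σ 0) R _ (hR (Or.inl (mem_range_self k))) _
    (hR (Or.inr (mem_range_self k))) t

/-- For an affine map, a nonempty maximal invariant set that lies well inside its neighborhood
already contains all bounded full orbits. -/
theorem maxInvariant_univ_eq_of_gap
    (hg : ∀ (t : unitInterval) μ ν, g (mix t μ ν) = mix t (g μ) (g ν))
    {N K : Set (WassersteinSpace p X)} (hN : IsClosed N) (hb : Bornology.IsBounded N) {r : ℝ}
    (hr : 0 < r) (hsub : Metric.thickening r K ⊆ N)
    (hgap : maxInvariant g N ⊆ Metric.thickening (r / 2) K) (hne : (maxInvariant g N).Nonempty) :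
    maxInvariant g univ = maxInvariant g N := by
  have hp0 : 0 < p := by linarith [hp.out]
  refine Subset.antisymm ?_ (maxInvariant_mono g (subset_univ N))
  rintro _ ⟨σ, rfl, -, hσ, hσb⟩
  obtain ⟨_, τ, -, hτN, hτ, -⟩ := hne
  obtain ⟨C₀, hC₀⟩ := Metric.isBounded_iff.1 (hσb.union hb)
  set C := max C₀ r with hC
  have hCpos : 0 < C := hr.trans_le (le_max_right _ _)
  have hCd : ∀ k, ∀ y ∈ N, dist (σ k) y ≤ C := fun k y hy =>
    (hC₀ (Or.inl (mem_range_self k)) (Or.inr hy)).trans (le_max_left _ _)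
  have hq0 : 0 < r / 4 / C := by positivity
  have hq1 : r / 4 / C ≤ 1 := by
    rw [div_le_one hCpos]
    linarith [le_max_right C₀ r]
  -- Chosen so that `u * C ^ p = (r / 4) ^ p`: mixing in the portion `u` of `σ` moves a point of `N`
  -- by at most `r / 4`.
  set u : unitInterval := ⟨(r / 4 / C) ^ p, by positivity, Real.rpow_le_one hq0.le hq1 hp0.le⟩
    with hu
  have hu0 : (0 : ℝ) < u := Real.rpow_pos_of_pos hq0 p
  have hu1 : (0 : ℝ) ≤ 1 - u := by linarith [u.2.2]
  let ρ : ℕ → ℤ → WassersteinSpace p X := fun j k => (mix u (σ k))^[j] (τ k)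
  have hρs : ∀ j k, ρ (j + 1) k = mix u (σ k) (ρ j k) := fun j k =>
    Function.iterate_succ_apply' _ _ _
  -- A full orbit in `N` lies in the `r / 2`-neighborhood by the gap, so a move by `r / 4` keeps it
  -- in the `r`-neighborhood and thus in `N`.
  have hρ : ∀ j, (∀ k, ρ j k ∈ N) ∧ ∀ k, g (ρ j k) = ρ j (k + 1) := by
    intro j
    induction j with
    | zero => exact ⟨hτN, hτ⟩
    | succ j ih =>
      refine ⟨fun k => hsub ?_, fun k => by rw [hρs, hρs, hg, hσ, ih.2]⟩
      obtain ⟨z, hz, hzd⟩ := Metric.mem_thickening_iff.1 (hgap (orbit_mem_maxInvariant ih.1 ih.2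
        (hb.subset (range_subset_iff.2 ih.1)) k))
      refine Metric.mem_thickening_iff.2 ⟨z, hz, ?_⟩
      have h1 : dist (ρ (j + 1) k) (ρ j k) ≤ r / 4 := by
        refine (Real.rpow_le_rpow_iff dist_nonneg (by positivity) hp0).1 ?_
        rw [hρs]
        refine (dist_mix_right_rpow_le u _ _).trans ?_
        refine (mul_le_mul_of_nonneg_left
          (Real.rpow_le_rpow dist_nonneg (hCd k _ (ih.1 k)) hp0.le) hu0.le).trans_eq ?_
        rw [hu, ← Real.mul_rpow hq0.le hCpos.le, div_mul_cancel₀ _ hCpos.ne']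
      linarith [dist_triangle (ρ (j + 1) k) (ρ j k) z]
  -- Each mixing contracts the distance to `σ`, so `σ` lies in the closure of `N`.
  have hconv : ∀ j k, dist (ρ j k) (σ k) ^ p ≤ (1 - u) ^ j * C ^ p := by
    intro j k
    induction j with
    | zero =>
      rw [pow_zero, one_mul, dist_comm]
      exact Real.rpow_le_rpow dist_nonneg (hCd k _ (hτN k)) hp0.le
    | succ j ih =>
      rw [hρs]
      refine (dist_mix_left_rpow_le u _ _).trans ?_
      rw [pow_succ', mul_assoc]
      exact mul_le_mul_of_nonneg_left ih hu1
  refine ⟨σ, rfl, fun k => ?_, hσ, hσb⟩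
  rw [← hN.closure_eq]
  refine Metric.mem_closure_iff.2 fun ε hε => ?_
  have hCp : 0 < C ^ p := Real.rpow_pos_of_pos hCpos p
  obtain ⟨j, hj⟩ := exists_pow_lt_of_lt_one
    (div_pos (Real.rpow_pos_of_pos hε p) hCp) (show 1 - (u : ℝ) < 1 by linarith)
  refine ⟨ρ j k, (hρ j).1 k, ?_⟩
  rw [dist_comm]
  refine (Real.rpow_lt_rpow_iff dist_nonneg hε.le hp0).1 ((hconv j k).trans_lt ?_)
  rwa [← lt_div_iff₀ hCp]

end Affine

/-! ### Fixed points by Cesàro means -/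

section FixedPoint

variable {X : Type*} [MetricSpace X] [MeasurableSpace X] [BorelSpace X]
  [SecondCountableTopology X] {p : ℝ}

/-- The Cesàro mean of `μ, P μ, …, P^m μ`. -/
noncomputable def cesaroMean (P : WassersteinSpace p X → WassersteinSpace p X)
    (μ : WassersteinSpace p X) : ℕ → WassersteinSpace p X
  | 0 => μ
  -- Stage `m + 1` averages `m + 2` measures, hence the weight of the new one.
  | m + 1 => mix ⟨1 / ((m : ℝ) + 2), by positivity,
      (div_le_one (by positivity)).2 (by linarith [(Nat.cast_nonneg m : (0 : ℝ) ≤ m)])⟩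
      (P^[m + 1] μ) (cesaroMean P μ m)

theorem cesaroMean_mem {P : WassersteinSpace p X → WassersteinSpace p X}
    {N : Set (WassersteinSpace p X)} (hconv : IsMixtureConvex N) (hmaps : MapsTo P N N)
    {μ : WassersteinSpace p X} (hμ : μ ∈ N) (m : ℕ) : cesaroMean P μ m ∈ N := by
  induction m with
  | zero => exact hμ
  | succ m ih => exact hconv _ (hmaps.iterate _ hμ) _ ih _

theorem lintegral_cesaroMean (P : WassersteinSpace p X → WassersteinSpace p X)
    (μ : WassersteinSpace p X) (g : X → ℝ≥0∞) (m : ℕ) :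
    ((m : ℝ≥0∞) + 1) * ∫⁻ x, g x ∂(cesaroMean P μ m).toMeasure
      = ∑ k ∈ Finset.range (m + 1), ∫⁻ x, g x ∂(P^[k] μ).toMeasure := by
  induction m with
  | zero => simp [cesaroMean]
  | succ m ih =>
    rw [Finset.sum_range_succ, ← ih, cesaroMean, lintegral_mix, mul_add, ← mul_assoc, ← mul_assoc,
      add_comm]
    have e : ((m + 1 : ℕ) : ℝ≥0∞) + 1 = ENNReal.ofReal ((m : ℝ) + 2) := by
      rw [ENNReal.ofReal_add (by positivity) (by positivity), ENNReal.ofReal_natCast]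
      push_cast
      rw [add_assoc, one_add_one_eq_two]
      simp
    have hm : (0 : ℝ) < (m : ℝ) + 2 := by positivity
    rw [e, ← ENNReal.ofReal_mul hm.le, ← ENNReal.ofReal_mul hm.le]
    congr 2
    · rw [mul_sub, mul_one_div_cancel hm.ne', mul_one,
        show (m : ℝ) + 2 - 1 = m + 1 by ring, ENNReal.ofReal_add (by positivity) (by positivity)]
      simp
    · rw [mul_one_div_cancel hm.ne']
      simp

variable [CompleteSpace X] [hp : Fact (1 ≤ p)] {f : X → X} {M : ℝ}
  {P : WassersteinSpace p X → WassersteinSpace p X}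

/-- A Markov-Wasserstein map has a fixed point in every nonempty, convex, weakly compact, positive
invariant set. -/
theorem IsMWMap.exists_fixed (hP : IsMWMap f M P) {N : Set (WassersteinSpace p X)}
    (hN : @IsCompact _ (weakTopology p X) N) (hconv : IsMixtureConvex N) (hmaps : MapsTo P N N)
    (hne : N.Nonempty) : ∃ μ ∈ N, P μ = μ := by
  obtain ⟨μ, hμ⟩ := hne
  let 𝒰 : Ultrafilter ℕ := Ultrafilter.of atTop
  have h𝒰 : (𝒰 : Filter ℕ) ≤ atTop := Ultrafilter.of_le _
  obtain ⟨ν, hνN, hν⟩ := @IsCompact.ultrafilter_le_nhds _ (weakTopology p X) N hN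
    (𝒰.map (cesaroMean P μ))
    (le_principal_iff.2 (Filter.mem_map.2 (Eventually.of_forall (cesaroMean_mem hconv hmaps hμ))))
  have hlim : ∀ g : BoundedContinuousFunction X NNReal,
      Tendsto (fun m => ∫⁻ x, g x ∂(cesaroMean P μ m).toMeasure) 𝒰
        (𝓝 (∫⁻ x, g x ∂ν.toMeasure)) := fun g =>
    (@Continuous.tendsto _ _ (weakTopology p X) _ _ (continuous_weak_lintegral g) ν).comp hν
  refine ⟨ν, hνN, toMeasure_eq_of_forall_lintegral_eq fun g => ?_⟩
  obtain ⟨h, hh⟩ := hP.exists_dual g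
  rw [hh]
  obtain ⟨C, hC⟩ : ∃ C : NNReal, ∀ x, g x ≤ C := ⟨nndist g 0, fun x => by
    simpa using g.nndist_coe_le_nndist (g := 0) x⟩
  have hbound : ∀ k, ∫⁻ x, g x ∂(P^[k] μ).toMeasure ≤ C := fun k => by
    refine (lintegral_mono fun x => ENNReal.coe_le_coe.2 (hC x)).trans_eq ?_
    simp
  -- The two sums telescope up to their end terms, which are moved across because subtraction in
  -- `ℝ≥0∞` truncates.
  have hdiff : ∀ m : ℕ, ((m : ℝ≥0∞) + 1) * ∫⁻ x, h x ∂(cesaroMean P μ m).toMeasure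
      + ∫⁻ x, g x ∂(P^[0] μ).toMeasure
      = ((m : ℝ≥0∞) + 1) * ∫⁻ x, g x ∂(cesaroMean P μ m).toMeasure
        + ∫⁻ x, g x ∂(P^[m + 1] μ).toMeasure := fun m => by
    rw [lintegral_cesaroMean, lintegral_cesaroMean, ← Finset.sum_range_succ,
      Finset.sum_range_succ' (fun k => ∫⁻ x, g x ∂(P^[k] μ).toMeasure)]
    congr 1
    refine Finset.sum_congr rfl fun k _ => ?_
    rw [← hh, Function.iterate_succ_apply']
  have hdiv : ∀ (m : ℕ) (a b x y : ℝ≥0∞), ((m : ℝ≥0∞) + 1) * a + x = ((m : ℝ≥0∞) + 1) * b + y →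
      y ≤ C → a ≤ b + C / ((m : ℝ≥0∞) + 1) := by
    intro m a b x y hxy hy
    have h0 : ((m : ℝ≥0∞) + 1) ≠ 0 := by simp
    have ht : ((m : ℝ≥0∞) + 1) ≠ ∞ := by simp
    refine (ENNReal.mul_le_mul_iff_right h0 ht).1 ?_
    rw [mul_add, ENNReal.mul_div_cancel h0 ht]
    exact le_self_add.trans (hxy.le.trans (by gcongr))
  have hzero : Tendsto (fun m : ℕ => (C : ℝ≥0∞) / ((m : ℝ≥0∞) + 1)) 𝒰 (𝓝 0) := by
    have h1 : Tendsto (fun m : ℕ => (C : ℝ≥0∞) / ((m + 1 : ℕ) : ℝ≥0∞)) atTop (𝓝 0) :=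
      (ENNReal.Tendsto.const_div (ENNReal.tendsto_nat_nhds_top.comp (tendsto_add_atTop_nat 1))
        (Or.inr ENNReal.coe_ne_top)).trans (by simp)
    simpa using h1.mono_left h𝒰
  refine le_antisymm ?_ ?_
  · have := (hlim g).add hzero
    rw [add_zero] at this
    exact le_of_tendsto_of_tendsto' (hlim h) this fun m => hdiv m _ _ _ _ (hdiff m) (hbound _)
  · have := (hlim h).add hzero
    rw [add_zero] at this
    exact le_of_tendsto_of_tendsto' (hlim g) this fun m =>
      hdiv m _ _ _ _ (hdiff m).symm (hbound _)

end FixedPoint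

end MarkovWasserstein

/-! ### The main theorem -/

theorem mainTheorem6 {X : Type*} [MetricSpace X] [ProperSpace X] [Nonempty X]
    [MeasurableSpace X] [BorelSpace X] (p : ℝ) [Fact (1 ≤ p)]
    (f : X → X) (hf : Continuous f)
    (F : MarkovWasserstein.WassersteinSpace p X → MarkovWasserstein.WassersteinSpace p X)
    (hF : MarkovWasserstein.IsTransferMap f F) (hFcont : Continuous F)
    (K : Set (MarkovWasserstein.WassersteinSpace p X))
    (hK : MarkovWasserstein.IsGlobalAttractor F K)
    (hunif : ∃ U ∈ 𝓝ˢ K, UniformContinuousOn F U)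
    (P : ℕ → MarkovWasserstein.WassersteinSpace p X → MarkovWasserstein.WassersteinSpace p X)
    (ε : ℕ → ℝ) (hε : Tendsto ε atTop (𝓝 0))
    (hP : ∀ n, MarkovWasserstein.IsMWMap f (ε n) (P n))
    (N : Set (MarkovWasserstein.WassersteinSpace p X))
    (hN : MarkovWasserstein.IsIsolatingNhd F N K) :
    ∃ B ⊆ N, MarkovWasserstein.IsMixtureConvex B ∧ MapsTo F B B ∧
      MarkovWasserstein.IsIsolatingNhd F B K ∧ MarkovWasserstein.IsAdmissible F B ∧
      ∃ r > 0, ∃ n₀ : ℕ, ∀ n ≥ n₀,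
        ∃ Nn ⊆ B, Metric.thickening r K ⊆ Nn ∧
          MarkovWasserstein.IsMixtureConvex Nn ∧ MapsTo (P n) Nn Nn ∧
          ∃ Kn, MarkovWasserstein.IsIsolatingNhd (P n) Nn Kn ∧
            Kn.Nonempty ∧
            @IsCompact _ (MarkovWasserstein.weakTopology p X) Kn ∧
            MarkovWasserstein.IsWeakAttractor (MarkovWasserstein.weakTopology p X) (P n) Kn ∧
            MarkovWasserstein.maxInvariant (P n) univ = Kn ∧
            ∃ μ ∈ Kn, P n μ = μ := by
  obtain ⟨U, hU, hFU⟩ := hunif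
  obtain ⟨u₀, hu₀, hsub₀⟩ := hK.isCompact.exists_thickening_subset_open
    (isOpen_interior.inter isOpen_interior)
    (subset_inter hN.subset_interior (subset_interior_iff_mem_nhdsSet.2 hU))
  -- Halved because shadowing in the `u`-neighborhood uses uniform continuity on the `2 *
  -- u`-neighborhood.
  set u := u₀ / 2 with hu
  have hu' : 0 < u := half_pos hu₀
  have hu2 : 2 * u = u₀ := by rw [hu]; ring
  -- This cost bound places `D` between the `u / 2`- and the `u`-neighborhood of `K`.
  set D := MarkovWasserstein.couplingNhd K (ENNReal.ofReal (u / 2) ^ p) with hD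
  have hDu : D ⊆ Metric.thickening u K :=
    MarkovWasserstein.couplingNhd_subset_thickening K (by positivity) (half_lt_self hu')
  have hKD : Metric.thickening (u / 2) K ⊆ D :=
    MarkovWasserstein.thickening_subset_couplingNhd K (u / 2)
  have hDb : Bornology.IsBounded D := hK.isCompact.isBounded.thickening.subset hDu
  have hDw : @IsCompact _ (MarkovWasserstein.weakTopology p X) D :=
    MarkovWasserstein.isCompact_weak_couplingNhd hK.isCompact
      (ENNReal.rpow_ne_top_of_nonneg (by linarith [(Fact.out : 1 ≤ p)]) ENNReal.ofReal_ne_top)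
  have hDc : IsClosed D := MarkovWasserstein.isClosed_of_isClosed_weak
    (@IsCompact.isClosed _ (MarkovWasserstein.weakTopology p X) _ _ hDw)
  have hFmix := hF.map_mix hf.measurable
  have hKconv : MarkovWasserstein.IsMixtureConvex K := by
    rw [← hK.maxInvariant_univ]
    exact MarkovWasserstein.isMixtureConvex_maxInvariant_univ hFmix
  have hDconv : MarkovWasserstein.IsMixtureConvex D := hKconv.couplingNhd _
  set B := MarkovWasserstein.forwardCore F D with hB
  have hBD : B ⊆ D := MarkovWasserstein.forwardCore_subset F D
  have hBw : @IsCompact _ (MarkovWasserstein.weakTopology p X) B :=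
    @MarkovWasserstein.isCompact_forwardCore _ (MarkovWasserstein.weakTopology p X) _ _
      (hF.continuous_weak hf) _ hDw
  have hBc : IsClosed B := MarkovWasserstein.isClosed_forwardCore hFcont hDc
  have hBN : B ⊆ N := fun μ hμ => interior_subset
    (hsub₀ (Metric.thickening_mono (by linarith) K (hDu (hBD hμ)))).1
  refine ⟨B, hBN, hDconv.forwardCore hFmix, MarkovWasserstein.mapsTo_forwardCore F D,
    hK.isIsolatingNhd_forwardCore hFcont hDc (half_pos hu') hKD,
    hK.isAdmissible hBc (hDb.subset hBD), ?_⟩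
  obtain ⟨r, hr, n₀, hn₀⟩ := hK.eventually_perturbation hFcont hu'
    (hFU.mono (hu2 ▸ fun μ hμ => interior_subset (hsub₀ hμ).2)) hDb hDu (half_pos hu') hKD hε
    fun n => (hP n).dist_le hf.measurable hF
  refine ⟨r, hr, n₀, fun n hn => ?_⟩
  obtain ⟨hrN, hgap⟩ := hn₀ n hn
  set Nn := MarkovWasserstein.forwardCore (P n) B with hNn
  have hNB : Nn ⊆ B := MarkovWasserstein.forwardCore_subset (P n) B
  have hNw : @IsCompact _ (MarkovWasserstein.weakTopology p X) Nn :=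
    @MarkovWasserstein.isCompact_forwardCore _ (MarkovWasserstein.weakTopology p X) _ _
      (hP n).continuous_weak _ hBw
  have hNc : IsClosed Nn := MarkovWasserstein.isClosed_forwardCore (hP n).continuous hBc
  have hNb : Bornology.IsBounded Nn := hDb.subset (hNB.trans hBD)
  have hNmaps : MapsTo (P n) Nn Nn := MarkovWasserstein.mapsTo_forwardCore (P n) B
  have hNconv : MarkovWasserstein.IsMixtureConvex Nn :=
    (hDconv.forwardCore hFmix).forwardCore (hP n).convex_linear
  have : Nonempty (MarkovWasserstein.WassersteinSpace p X) :=
    ⟨MarkovWasserstein.diracW p (Classical.arbitrary X)⟩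
  -- The fixed point also shows that the invariant set is nonempty, which the gap argument requires.
  obtain ⟨μ, hμN, hμ⟩ := (hP n).exists_fixed hNw hNconv hNmaps
    (hK.nonempty.mono ((Metric.self_subset_thickening hr K).trans hrN))
  have hμK := MarkovWasserstein.mem_maxInvariant_of_fixed hμN hμ
  have hiso : MarkovWasserstein.IsIsolatingNhd (P n) Nn
      (MarkovWasserstein.maxInvariant (P n) Nn) :=
    ⟨MarkovWasserstein.maxInvariant_maxInvariant _ _, hNc,
      hgap.trans ((Metric.thickening_mono (by linarith) K).trans
        (interior_maximal hrN Metric.isOpen_thickening)), rfl⟩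
  exact ⟨Nn, hNB, hrN, hNconv, hNmaps, MarkovWasserstein.maxInvariant (P n) Nn, hiso, ⟨μ, hμK⟩,
    MarkovWasserstein.isCompact_maxInvariant _ (hP n).continuous_weak hNw hNb,
    ⟨(hP n).continuous_weak, (hP n).continuous_weak, Nn, hiso, hNmaps,
      MarkovWasserstein.weakOmega_subset_maxInvariant _ (hP n).continuous_weak hNw hNb hNmaps⟩,
    MarkovWasserstein.maxInvariant_univ_eq_of_gap (hP n).convex_linear hNc hNb hr hrN hgap
      ⟨μ, hμK⟩, μ, hμK, hμ⟩
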